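/- Alphabets are finite sets. For a word $w\in X^*$ let $\Psi(w)\in\mathbb N^X$ be its Parikh vector, i.e. $\Psi(w)(x)$ is the number of occurrences of $x$ in $w$, and let $\Psi(L)=\{\Psi(w)\mid w\in L\}$ for $L\subseteq X^*$. *Finite-index languages.* Let $G=(N,T,P,S)$ be a context-free grammar in Chomsky normal form, meaning that every production $A\to w$ has $w\in N^2\cup T\cup\{\varepsilon\}$. For $k\ge 1$ let $L_k(G)$ be the set of words in $T^*$ that can be derived from $S$ by a derivation in which every sentential form contains at most $k$ occurrences of nonterminals. Let $\mathsf{fiCF}$ be the class of all languages $L_k(G)$ for such $G$ and $k\ge 1$. *Petri net languages.* A $d$-dimensional labeled Petri net over $X$ consists of a finite set of transitions in $(X\cup\{\varepsilon\})\times\mathbb Z^d$, an initial marking in $\mathbb N^d$ and a finite set of final markings in $\mathbb N^d$. A transition $(x,\nu)$ leads from $\mu\in\mathbb N^d$ to $\mu+\nu$, provided that $\mu+\nu\in\mathbb N^d$, and reads $x$. The generated language consists of the words read on firing sequences from the initial marking to a final marking. Let $\mathsf P$ be the class of all these languages. *The class $\mathsf{fiCF}\sqcap\mathsf P$* consists of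 all languages $h(K\cap L)\subseteq Y^*$, where $K,L\subseteq X^*$ for some alphabet $X$, $K\in\mathsf{fiCF}$, $L\in\mathsf P$, and $h\colon X^*\to Y^*$ is a morphism. Such a language is represented by a grammar $G$ in Chomsky normal form, a number $k\ge 1$, a Petri net, and the images under $h$ of the letters. *Priority multicounter machines.* A priority $k$-counter machine over $Y$ consists of a finite state set $Q$, an initial state $q_0\in Q$, a set $F\subseteq Q$ of final states and a finite set of edges in $Q\times Y^*\times\{0,\dots,k\}\times\mathbb Z^k\times Q$. An edge $(p,w,\ell,\nu,q)$ leads from a configuration $(p,\mu)\in Q\times\mathbb N^k$ to $(q,\mu+\nu)$ and reads $w$, provided that $\mu_1=\dots=\mu_\ell=0$ and $\mu+\nu\in\mathbb N^k$. The machine accepts the words read on runs from $(q_0,0)$ to $(f,0)$ with $f\in F$. A priority multicounter machine is a priority $k$-counter machine for some $k\in\mathbb N$. **Theorem.** For every language $K$ in $\mathsf{fiCF}\sqcap\mathsf P$ there is a priority multicounter machine $\mathcal A$ (over the alphabet of $K$) with $\Psi(L(\mathcal A))=\Psi(K)$. Moreover, $\mathcal A$ can be constructed effectively: there is a computable function that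 maps every representation of a language $K\in\mathsf{fiCF}\sqcap\mathsf P$ to a priority multicounter machine $\mathcal A$ with $\Psi(L(\mathcal A))=\Psi(K)$. -/

import Mathlib

/-! ### Parikh images -/

/-- The Parikh map: `parikh w x` is the number of occurrences of the letter `x` in `w`. -/
def parikh {X : Type*} [DecidableEq X] (w : List X) : X → ℕ := fun x => w.count x

/-- The Parikh image of a language. -/
def parikhImage {X : Type*} [DecidableEq X] (L : Language X) : Set (X → ℕ) :=
  {v | ∃ w ∈ L, parikh w = v}

/-! ### Finite-index context-free languages -/

/-- Whether a grammar symbol is a nonterminal. -/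
def symbolIsNonterminal {T N : Type*} : Symbol T N → Bool
  | .terminal _ => false
  | .nonterminal _ => true

/-- The number of occurrences of nonterminals in a sentential form. -/
def nonterminalCount {T N : Type*} (u : List (Symbol T N)) : ℕ :=
  u.countP symbolIsNonterminal

/-- Chomsky normal form: each right-hand side is two nonterminals, or one terminal, or empty. -/
def IsChomskyNF {T : Type} (G : ContextFreeGrammar.{0} T) : Prop :=
  ∀ r ∈ G.rules,
    (∃ B C : G.NT, r.output = [Symbol.nonterminal B, Symbol.nonterminal C]) ∨
    (∃ a : T, r.output = [Symbol.terminal a]) ∨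
    r.output = []

/-- A derivation step between sentential forms with at most `k` nonterminal occurrences each. -/
def BoundedStep {T : Type} (G : ContextFreeGrammar.{0} T) (k : ℕ)
    (u v : List (Symbol T G.NT)) : Prop :=
  nonterminalCount u ≤ k ∧ nonterminalCount v ≤ k ∧ G.Produces u v

/-- The `k`-approximation of the language of a grammar: the terminal words that are derivable
from the start symbol by steps with at most `k` nonterminal occurrences. -/
def approximation {T : Type} (G : ContextFreeGrammar.{0} T) (k : ℕ) : Language T :=
  {w | Relation.ReflTransGen (BoundedStep G k)
    [Symbol.nonterminal G.initial] (w.map Symbol.terminal)}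

/-- Index-`k` context-free languages. A grammar has finitely many rules, so only finitely many
elements of the type `G.NT` matter. -/
def IsIndexCF {T : Type} (k : ℕ) (L : Language T) : Prop :=
  ∃ G : ContextFreeGrammar.{0} T, IsChomskyNF G ∧ L = approximation G k

/-- Finite-index context-free languages. -/
def IsFiniteIndexCF {T : Type} (L : Language T) : Prop :=
  ∃ k : ℕ, 1 ≤ k ∧ IsIndexCF k L

/-! ### Petri net languages -/

/-- A `d`-dimensional labeled Petri net; the label `none` stands for the empty word. -/
structure PetriNet (X : Type*) (d : ℕ) where
  transitions : Finset (Option X × (Fin d → ℤ))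
  initial : Fin d → ℕ
  final : Finset (Fin d → ℕ)

/-- `N.Run μ w μ'`: the word `w` labels a firing sequence from marking `μ` to marking `μ'`. -/
inductive PetriNet.Run {X : Type*} {d : ℕ} (N : PetriNet X d) :
    (Fin d → ℕ) → List X → (Fin d → ℕ) → Prop
  | nil (μ : Fin d → ℕ) : N.Run μ [] μ
  | cons {μ μ₁ μ' : Fin d → ℕ} {x : Option X} {ν : Fin d → ℤ} {w : List X}
      (mem : (x, ν) ∈ N.transitions) (fire : ∀ i, (μ₁ i : ℤ) = (μ i : ℤ) + ν i)
      (rest : N.Run μ₁ w μ') : N.Run μ (x.toList ++ w) μ'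

/-- The language generated by a Petri net. -/
def PetriNet.language {X : Type*} {d : ℕ} (N : PetriNet X d) : Language X :=
  {w | ∃ μ ∈ N.final, N.Run N.initial w μ}

/-- Petri net languages. -/
def IsPetriNetLanguage {X : Type*} (L : Language X) : Prop :=
  ∃ (d : ℕ) (N : PetriNet X d), L = N.language

/-! ### The class `C ⊓ D` -/

/-- `h(K ∩ L)`, for the morphism that is given by `h` on letters. -/
def morphicIntersection {X Y : Type*} (h : X → List Y) (K L : Language X) : Language Y :=
  {v | ∃ w, w ∈ K ∧ w ∈ L ∧ w.flatMap h = v}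

/-- Membership in `C ⊓ D`: the language is `h(K ∩ L)` with `K` in `C`, `L` in `D` over some
common finite alphabet, and `h` a morphism. -/
def InTrioIntersection (C D : (X : Type) → Language X → Prop) {Y : Type*} (M : Language Y) :
    Prop :=
  ∃ (X : Type) (_ : Finite X) (h : X → List Y) (K L : Language X),
    C X K ∧ D X L ∧ M = morphicIntersection h K L

/-! ### Priority multicounter machines -/

/-- A priority `k`-counter machine. An edge `(p, w, ℓ, ν, q)` goes from state `p` to `q`, reads
`w`, tests that the first `ℓ` counters are zero and adds `ν` to the counters. -/
structure PriorityMachine (X : Type*) (k : ℕ) where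
  State : Type
  finite_state : Finite State
  edges : Finset (State × List X × Fin (k + 1) × (Fin k → ℤ) × State)
  start : State
  final : Set State

/-- `A.Run p μ w q μ'`: the machine can go from configuration `(p, μ)` to `(q, μ')`
reading `w`. -/
inductive PriorityMachine.Run {X : Type*} {k : ℕ} (A : PriorityMachine X k) :
    A.State → (Fin k → ℕ) → List X → A.State → (Fin k → ℕ) → Prop
  | nil (p : A.State) (μ : Fin k → ℕ) : A.Run p μ [] p μ
  | cons {p p₁ q : A.State} {μ μ₁ μ' : Fin k → ℕ} {u w : List X} {l : Fin (k + 1)}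
      {ν : Fin k → ℤ} (mem : (p, u, l, ν, p₁) ∈ A.edges)
      (test : ∀ i : Fin k, (i : ℕ) < (l : ℕ) → μ i = 0)
      (add : ∀ i, (μ₁ i : ℤ) = (μ i : ℤ) + ν i)
      (rest : A.Run p₁ μ₁ w q μ') : A.Run p μ (u ++ w) q μ'

/-- The language accepted by a machine: runs go from the start state to a final state, with all
counters zero at the beginning and at the end. -/
def PriorityMachine.language {X : Type*} {k : ℕ} (A : PriorityMachine X k) : Language X :=
  {w | ∃ f ∈ A.final, A.Run A.start 0 w f 0}

/-! ### Finite representations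

For effectiveness, letters, nonterminals and states are natural numbers. The alphabets are the
finite sets of numbers that occur; vectors are lists, read as padded by zeros. -/

/-- A context-free grammar: start symbol and productions (`inl`: terminal,
`inr`: nonterminal). -/
structure GrammarCode where
  start : ℕ
  rules : List (ℕ × List (ℕ ⊕ ℕ))

/-- The grammar symbol that is represented by an element of `ℕ ⊕ ℕ`. -/
def symbolOfCode : ℕ ⊕ ℕ → Symbol ℕ ℕ
  | .inl a => .terminal a
  | .inr A => .nonterminal A

/-- The set of productions that is represented by a code. -/
def GrammarCode.ruleSet (c : GrammarCode) : Finset (ContextFreeRule ℕ ℕ) :=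
  (c.rules.map fun r => ContextFreeRule.mk r.1 (r.2.map symbolOfCode)).toFinset

/-- The grammar that is represented by a code. -/
def GrammarCode.toGrammar (c : GrammarCode) : ContextFreeGrammar.{0} ℕ where
  NT := ℕ
  initial := c.start
  rules := c.ruleSet

/-- A Petri net: dimension, transitions, initial marking, final markings. -/
structure PetriNetCode where
  dim : ℕ
  transitions : List (Option ℕ × List ℤ)
  initial : List ℕ
  final : List (List ℕ)

/-- The vector with the entries of a list, padded by zeros or cut off. -/
def vectorOfList {R : Type*} [Zero R] (d : ℕ) (l : List R) : Fin d → R :=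
  fun i => l.getD i 0

/-- The Petri net that is represented by a code. -/
def PetriNetCode.toPetriNet (c : PetriNetCode) : PetriNet ℕ c.dim where
  transitions := (c.transitions.map fun t => (t.1, vectorOfList c.dim t.2)).toFinset
  initial := vectorOfList c.dim c.initial
  final := (c.final.map (vectorOfList c.dim)).toFinset

/-- A representation of a language `h(K ∩ L)`: a grammar and an index bound for `K`, a Petri net
for `L`, and the list `h(0), h(1), …` of the images of the letters (later letters are mapped
to the empty word). -/
structure LanguageCode where
  grammar : GrammarCode
  index : ℕ
  net : PetriNetCode
  images : List (List ℕ)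

/-- A language code is valid if its grammar is in Chomsky normal form and its index is
positive. -/
def LanguageCode.Valid (c : LanguageCode) : Prop :=
  IsChomskyNF c.grammar.toGrammar ∧ 1 ≤ c.index

/-- The language that is represented by a code. -/
def LanguageCode.language (c : LanguageCode) : Language ℕ :=
  morphicIntersection (fun x => c.images.getD x [])
    (approximation c.grammar.toGrammar c.index) c.net.toPetriNet.language

/-- A priority multicounter machine: number `k` of counters, largest state `n`, edges, start
state, final states. -/
structure MachineCode where
  counters : ℕ
  maxState : ℕ
  edges : List (ℕ × List ℕ × ℕ × List ℤ × ℕ)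
  start : ℕ
  final : List ℕ

/-- The machine that is represented by a code, with state set `{0, …, n}`. Numbers of states are
read modulo `n + 1` and numbers of tested counters modulo `k + 1`, so that every code represents
a machine. -/
def MachineCode.toMachine (c : MachineCode) : PriorityMachine ℕ c.counters where
  State := Fin (c.maxState + 1)
  finite_state := inferInstance
  edges := (c.edges.map fun e =>
    (Fin.ofNat (c.maxState + 1) e.1, e.2.1, Fin.ofNat (c.counters + 1) e.2.2.1,
      vectorOfList c.counters e.2.2.2.1, Fin.ofNat (c.maxState + 1) e.2.2.2.2)).toFinset
  start := Fin.ofNat (c.maxState + 1) c.start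
  final := {q | ∃ n ∈ c.final, q = Fin.ofNat (c.maxState + 1) n}

def GrammarCode.equiv : GrammarCode ≃ ℕ × List (ℕ × List (ℕ ⊕ ℕ)) where
  toFun c := (c.start, c.rules)
  invFun p := ⟨p.1, p.2⟩
  left_inv _ := rfl
  right_inv _ := rfl

instance GrammarCode.primcodable : Primcodable GrammarCode :=
  Primcodable.ofEquiv _ GrammarCode.equiv

def PetriNetCode.equiv :
    PetriNetCode ≃ ℕ × List (Option ℕ × List ℤ) × List ℕ × List (List ℕ) where
  toFun c := (c.dim, c.transitions, c.initial, c.final)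
  invFun p := ⟨p.1, p.2.1, p.2.2.1, p.2.2.2⟩
  left_inv _ := rfl
  right_inv _ := rfl

instance PetriNetCode.primcodable : Primcodable PetriNetCode :=
  Primcodable.ofEquiv _ PetriNetCode.equiv

def LanguageCode.equiv :
    LanguageCode ≃ GrammarCode × ℕ × PetriNetCode × List (List ℕ) where
  toFun c := (c.grammar, c.index, c.net, c.images)
  invFun p := ⟨p.1, p.2.1, p.2.2.1, p.2.2.2⟩
  left_inv _ := rfl
  right_inv _ := rfl

instance LanguageCode.primcodable : Primcodable LanguageCode :=
  Primcodable.ofEquiv _ LanguageCode.equiv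

def MachineCode.equiv :
    MachineCode ≃ ℕ × ℕ × List (ℕ × List ℕ × ℕ × List ℤ × ℕ) × ℕ × List ℕ where
  toFun c := (c.counters, c.maxState, c.edges, c.start, c.final)
  invFun p := ⟨p.1, p.2.1, p.2.2.1, p.2.2.2.1, p.2.2.2.2⟩
  left_inv _ := rfl
  right_inv _ := rfl

instance MachineCode.primcodable : Primcodable MachineCode :=
  Primcodable.ofEquiv _ MachineCode.equiv

/-!
In a derivation of index `k` of a grammar in Chomsky normal form, read backwards, the nonterminal
occurrences of each sentential form can be given distinct levels below `k`, since a binary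
production merges two distinct levels into their maximum. Hence words of index `k` are the yields of
derivation trees of Horton–Strahler number less than `k`, in which one of the two children of each
node has a smaller number than the node.

Only the Parikh image of the accepted language matters, so the letters may be read in any order. The
machine builds such a tree together with a firing sequence of the Petri net that reads its yield.
Starting at a guessed leaf, it climbs the spine formed by the children of larger number and keeps
two markings, those at which the firing sequence for the current subtree starts and ends. For each
sibling on the spine, the callee, the same is done recursively with two markings on the next lower
level of counters, whence `k` levels suffice. The sibling's firing sequence may precede or follow
that of the spine; it is attached by cancelling the markings at which the two meet against each
other and moving the other marking of the sibling up. That both were moved completely is one zero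
test of all lower levels, that is, a priority test.
-/

/-! ### Horton–Strahler numbers of derivation trees -/

section StrahlerDerivations

variable {T : Type} {G : ContextFreeGrammar.{0} T}

/-- `StrahlerDerivation G l A w`: the word `w` has a derivation tree with root `A` whose
Horton–Strahler number is at most `l`, that is, whose subtrees can be given levels so that each leaf
production may have any level and of the two children of a node of level `l + 1` one has level at
most `l`. -/
inductive StrahlerDerivation (G : ContextFreeGrammar.{0} T) : ℕ → G.NT → List T → Prop
  | nil {A : G.NT} (l : ℕ) (mem : ContextFreeRule.mk A [] ∈ G.rules) :
      StrahlerDerivation G l A []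
  | leaf {A : G.NT} {t : T} (l : ℕ)
      (mem : ContextFreeRule.mk A [Symbol.terminal t] ∈ G.rules) :
      StrahlerDerivation G l A [t]
  | right {l : ℕ} {A B C : G.NT} {u w : List T}
      (mem : ContextFreeRule.mk A [Symbol.nonterminal B, Symbol.nonterminal C] ∈ G.rules)
      (hB : StrahlerDerivation G (l + 1) B u) (hC : StrahlerDerivation G l C w) :
      StrahlerDerivation G (l + 1) A (u ++ w)
  | left {l : ℕ} {A B C : G.NT} {u w : List T}
      (mem : ContextFreeRule.mk A [Symbol.nonterminal B, Symbol.nonterminal C] ∈ G.rules)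
      (hB : StrahlerDerivation G l B u) (hC : StrahlerDerivation G (l + 1) C w) :
      StrahlerDerivation G (l + 1) A (u ++ w)

/-- `LeveledYield G u ls w`: the word `w` is obtained from the sentential form `u` by replacing the
nonterminal occurrences, from left to right, with yields of derivation trees whose Horton–Strahler
numbers are at most the entries of `ls`. -/
inductive LeveledYield (G : ContextFreeGrammar.{0} T) :
    List (Symbol T G.NT) → List ℕ → List T → Prop
  | nil : LeveledYield G [] [] []
  | terminal {u : List (Symbol T G.NT)} {ls : List ℕ} {w : List T} (t : T)
      (rest : LeveledYield G u ls w) : LeveledYield G (.terminal t :: u) ls (t :: w)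
  | nonterminal {u : List (Symbol T G.NT)} {ls : List ℕ} {w w' : List T} {l : ℕ} {A : G.NT}
      (head : StrahlerDerivation G l A w) (rest : LeveledYield G u ls w') :
      LeveledYield G (.nonterminal A :: u) (l :: ls) (w ++ w')

theorem nonterminalCount_append {N : Type*} (u v : List (Symbol T N)) :
    nonterminalCount (u ++ v) = nonterminalCount u + nonterminalCount v :=
  List.countP_append

@[simp]
theorem nonterminalCount_map_terminal {N : Type*} (w : List T) :
    nonterminalCount (w.map (Symbol.terminal : T → Symbol T N)) = 0 := by
  simp [nonterminalCount, symbolIsNonterminal]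

theorem nonterminalCount_singleton {N : Type*} (A : N) :
    nonterminalCount [(Symbol.nonterminal A : Symbol T N)] = 1 := rfl

theorem reflTransGen_boundedStep_context {k m : ℕ} {u v : List (Symbol T G.NT)}
    (p q : List (Symbol T G.NT)) (hm : nonterminalCount p + nonterminalCount q + k ≤ m)
    (h : Relation.ReflTransGen (BoundedStep G k) u v) :
    Relation.ReflTransGen (BoundedStep G m) (p ++ u ++ q) (p ++ v ++ q) := by
  refine h.lift (p ++ · ++ q) fun u v h => ?_
  obtain ⟨hu, hv, huv⟩ := h
  refine ⟨?_, ?_, (huv.append_left p).append_right q⟩ <;>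
  · simp only [nonterminalCount_append]
    omega

theorem boundedStep_of_mem_rules {k : ℕ} {A : G.NT} {v : List (Symbol T G.NT)}
    (mem : ContextFreeRule.mk A v ∈ G.rules) (hk : 1 ≤ k) (hv : nonterminalCount v ≤ k) :
    BoundedStep G k [Symbol.nonterminal A] v :=
  ⟨hk, hv, _, mem, ContextFreeRule.Rewrites.input_output⟩

theorem StrahlerDerivation.mono {l m : ℕ} {A : G.NT} {w : List T}
    (h : StrahlerDerivation G l A w) (hlm : l ≤ m) : StrahlerDerivation G m A w := by
  induction h generalizing m with
  | nil l mem => exact .nil m mem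
  | leaf l mem => exact .leaf m mem
  | right mem _ _ ihB ihC =>
    obtain ⟨m, rfl⟩ := Nat.exists_eq_add_of_le' (Nat.one_le_of_lt hlm)
    exact .right mem (ihB hlm) (ihC (Nat.le_of_succ_le_succ hlm))
  | left mem _ _ ihB ihC =>
    obtain ⟨m, rfl⟩ := Nat.exists_eq_add_of_le' (Nat.one_le_of_lt hlm)
    exact .left mem (ihB (Nat.le_of_succ_le_succ hlm)) (ihC hlm)

theorem StrahlerDerivation.max_of_ne {i j : ℕ} {A B C : G.NT} {u w : List T}
    (mem : ContextFreeRule.mk A [Symbol.nonterminal B, Symbol.nonterminal C] ∈ G.rules)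
    (hB : StrahlerDerivation G i B u) (hC : StrahlerDerivation G j C w) (hij : i ≠ j) :
    StrahlerDerivation G (max i j) A (u ++ w) := by
  rcases hij.lt_or_gt with hij | hij
  · obtain ⟨j, rfl⟩ := Nat.exists_eq_add_of_le' (Nat.one_le_of_lt hij)
    rw [max_eq_right hij.le]
    exact .left mem (hB.mono (Nat.le_of_lt_succ hij)) hC
  · obtain ⟨i, rfl⟩ := Nat.exists_eq_add_of_le' (Nat.one_le_of_lt hij)
    rw [max_eq_left hij.le]
    exact .right mem hB (hC.mono (Nat.le_of_lt_succ hij))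

/-- The child of smaller Horton–Strahler number is derived first, while its sibling occupies one
nonterminal. -/
theorem StrahlerDerivation.reflTransGen_boundedStep {l : ℕ} {A : G.NT} {w : List T}
    (h : StrahlerDerivation G l A w) :
    Relation.ReflTransGen (BoundedStep G (l + 1)) [Symbol.nonterminal A]
      (w.map Symbol.terminal) := by
  induction h with
  | nil l mem => exact .single (boundedStep_of_mem_rules mem (by omega) (Nat.zero_le _))
  | leaf l mem => exact .single (boundedStep_of_mem_rules mem (by omega) (Nat.zero_le _))
  | @right l A B C u w mem _ _ ihB ihC =>
    have hC := reflTransGen_boundedStep_context (m := l + 2) [Symbol.nonterminal B] []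
      (by rw [nonterminalCount_singleton]; simp [nonterminalCount]; omega) ihC
    have hB := reflTransGen_boundedStep_context (m := l + 2) [] (w.map Symbol.terminal)
      (by rw [nonterminalCount_map_terminal]; simp [nonterminalCount]) ihB
    refine .head (boundedStep_of_mem_rules mem (by omega) (Nat.le_add_left 2 l)) ?_
    simpa using hC.trans (by simpa using hB)
  | @left l A B C u w mem _ _ ihB ihC =>
    have hB := reflTransGen_boundedStep_context (m := l + 2) [] [Symbol.nonterminal C]
      (by rw [nonterminalCount_singleton]; simp [nonterminalCount]; omega) ihB
    have hC := reflTransGen_boundedStep_context (m := l + 2) (u.map Symbol.terminal) []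
      (by rw [nonterminalCount_map_terminal]; simp [nonterminalCount]) ihC
    refine .head (boundedStep_of_mem_rules mem (by omega) (Nat.le_add_left 2 l)) ?_
    simpa using hB.trans (by simpa using hC)

theorem LeveledYield.map_terminal (w : List T) :
    LeveledYield G (w.map Symbol.terminal) [] w := by
  induction w with
  | nil => exact .nil
  | cons t w ih => exact .terminal t ih

theorem LeveledYield.length_eq {u : List (Symbol T G.NT)} {ls : List ℕ} {w : List T}
    (h : LeveledYield G u ls w) : ls.length = nonterminalCount u := by
  induction h with
  | nil => rfl
  | terminal t _ ih => simpa [nonterminalCount, symbolIsNonterminal] using ih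
  | nonterminal _ _ ih =>
    simpa [nonterminalCount, List.countP_cons, symbolIsNonterminal] using ih

theorem LeveledYield.append {u v : List (Symbol T G.NT)} {ls ls' : List ℕ} {w w' : List T}
    (hu : LeveledYield G u ls w) (hv : LeveledYield G v ls' w') :
    LeveledYield G (u ++ v) (ls ++ ls') (w ++ w') := by
  induction hu with
  | nil => exact hv
  | terminal t _ ih => exact .terminal t ih
  | nonterminal head _ ih =>
    rw [List.append_assoc]
    exact .nonterminal head ih

theorem LeveledYield.exists_of_append {u v : List (Symbol T G.NT)} {ls : List ℕ} {w : List T}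
    (h : LeveledYield G (u ++ v) ls w) :
    ∃ ls₁ ls₂ w₁ w₂, LeveledYield G u ls₁ w₁ ∧ LeveledYield G v ls₂ w₂ ∧
      ls = ls₁ ++ ls₂ ∧ w = w₁ ++ w₂ := by
  induction u generalizing ls w with
  | nil => exact ⟨[], ls, [], w, .nil, h, rfl, rfl⟩
  | cons s u ih =>
    cases h with
    | terminal t rest =>
      obtain ⟨ls₁, ls₂, w₁, w₂, hu, hv, rfl, rfl⟩ := ih rest
      exact ⟨ls₁, ls₂, t :: w₁, w₂, .terminal t hu, hv, rfl, rfl⟩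
    | nonterminal head rest =>
      obtain ⟨ls₁, ls₂, w₁, w₂, hu, hv, rfl, rfl⟩ := ih rest
      exact ⟨_ :: ls₁, ls₂, _ ++ w₁, w₂, .nonterminal head hu, hv, rfl,
        (List.append_assoc ..).symm⟩

theorem LeveledYield.strahlerDerivation_of_mem_rules (hG : IsChomskyNF G) {A : G.NT}
    {v : List (Symbol T G.NT)} {ls : List ℕ} {w : List T}
    (mem : ContextFreeRule.mk A v ∈ G.rules) (h : LeveledYield G v ls w) (hls : ls.Nodup) :
    (∃ l ∈ ls, StrahlerDerivation G l A w) ∨ ls = [] ∧ ∀ l, StrahlerDerivation G l A w := by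
  rcases hG _ mem with ⟨B, C, hv⟩ | ⟨a, hv⟩ | hv <;> obtain rfl : v = _ := hv
  · cases h with | @nonterminal _ _ u _ i _ hB rest =>
    cases rest with | @nonterminal _ _ w _ j _ hC rest =>
    cases rest
    have hij : i ≠ j := by simpa using hls
    refine .inl ⟨max i j, ?_, ?_⟩
    · rcases max_choice i j with h | h <;> simp [h]
    · simpa using StrahlerDerivation.max_of_ne mem hB hC hij
  · cases h with | terminal _ rest =>
    cases rest
    exact .inr ⟨rfl, fun l => .leaf l mem⟩
  · cases h
    exact .inr ⟨rfl, fun l => .nil l mem⟩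

/-- A binary production merges two distinct levels into their maximum; any other production
introduces a nonterminal, for which the bound on the sentential form leaves a free level. -/
theorem LeveledYield.exists_of_produces (hG : IsChomskyNF G) {k : ℕ}
    {u v : List (Symbol T G.NT)} {ls : List ℕ} {w : List T} (hu : nonterminalCount u ≤ k)
    (huv : G.Produces u v) (h : LeveledYield G v ls w) (hls : ls.Nodup) (hk : ∀ l ∈ ls, l < k) :
    ∃ ls', LeveledYield G u ls' w ∧ ls'.Nodup ∧ ∀ l ∈ ls', l < k := by
  obtain ⟨r, hr, huv⟩ := huv
  obtain ⟨p, q, rfl, rfl⟩ := huv.exists_parts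
  obtain ⟨_, lq, _, wq, hpr, hq, rfl, rfl⟩ := h.exists_of_append
  obtain ⟨lp, lr, wp, wr, hp, hout, rfl, rfl⟩ := hpr.exists_of_append
  have yield_of_level : ∀ l, StrahlerDerivation G l r.input wr →
      LeveledYield G (p ++ [Symbol.nonterminal r.input] ++ q) (lp ++ [l] ++ lq)
        (wp ++ wr ++ wq) := fun l hl => by
    simpa using (hp.append (.nonterminal hl .nil)).append hq
  rcases hout.strahlerDerivation_of_mem_rules hG hr
    (hls.sublist ((List.sublist_append_right ..).trans (List.sublist_append_left ..)))
    with ⟨l, hl, hA⟩ | ⟨rfl, hA⟩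
  · have hsub : (lp ++ [l] ++ lq).Sublist (lp ++ lr ++ lq) :=
      ((List.singleton_sublist.2 hl).append_left lp).append_right lq
    exact ⟨_, yield_of_level l hA, hls.sublist hsub, fun m hm => hk m (hsub.subset hm)⟩
  · rw [List.append_nil] at hls hk
    have hcard : (lp ++ lq).length < k := by
      have := hp.length_eq
      have := hq.length_eq
      simp only [nonterminalCount_append, nonterminalCount_singleton] at hu
      rw [List.length_append]
      omega
    obtain ⟨l, hlk, hl⟩ : ∃ l ∈ List.range k, l ∉ lp ++ lq := by
      by_contra! hall
      have := (List.subperm_of_subset List.nodup_range hall).length_le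
      rw [List.length_range] at this
      omega
    have hperm : (lp ++ [l] ++ lq).Perm (l :: (lp ++ lq)) := by simp
    refine ⟨_, yield_of_level l (hA l), hperm.nodup_iff.2 (List.nodup_cons.2 ⟨hl, hls⟩), ?_⟩
    intro m hm
    rcases List.mem_cons.1 (hperm.subset hm) with rfl | hm
    · exact List.mem_range.1 hlk
    · exact hk m hm

theorem exists_leveledYield (hG : IsChomskyNF G) {k : ℕ} {u : List (Symbol T G.NT)} {w : List T}
    (h : Relation.ReflTransGen (BoundedStep G k) u (w.map Symbol.terminal)) :
    ∃ ls, LeveledYield G u ls w ∧ ls.Nodup ∧ ∀ l ∈ ls, l < k := by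
  induction h using Relation.ReflTransGen.head_induction_on with
  | refl => exact ⟨[], .map_terminal w, List.nodup_nil, by simp⟩
  | head step _ ih =>
    obtain ⟨ls, hv, hls, hk⟩ := ih
    exact hv.exists_of_produces hG step.1 step.2.2 hls hk

theorem mem_approximation_succ_iff (hG : IsChomskyNF G) {l : ℕ} {w : List T} :
    w ∈ approximation G (l + 1) ↔ StrahlerDerivation G l G.initial w := by
  refine ⟨fun h => ?_, StrahlerDerivation.reflTransGen_boundedStep⟩
  obtain ⟨_, hu, -, hk⟩ := exists_leveledYield hG h
  cases hu with | nonterminal hA rest =>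
  cases rest
  simpa using hA.mono (Nat.le_of_lt_succ (hk _ (by simp)))

end StrahlerDerivations

/-! ### Firing sequences -/

section FiringSequences

variable {X : Type*} {d : ℕ} {N : PetriNet X d}

theorem PetriNet.Run.append {a m b : Fin d → ℕ} {u w : List X} (h₁ : N.Run a u m)
    (h₂ : N.Run m w b) : N.Run a (u ++ w) b := by
  induction h₁ with
  | nil => exact h₂
  | cons mem fire _ ih =>
    rw [List.append_assoc]
    exact .cons mem fire (ih h₂)

theorem PetriNet.Run.exists_of_append {a b : Fin d → ℕ} {u w : List X}
    (h : N.Run a (u ++ w) b) : ∃ m, N.Run a u m ∧ N.Run m w b := by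
  generalize hv : u ++ w = v at h
  induction h generalizing u with
  | nil μ =>
    obtain ⟨rfl, rfl⟩ := List.append_eq_nil_iff.1 hv
    exact ⟨μ, .nil μ, .nil μ⟩
  | @cons μ μ₁ μ' x ν v mem fire rest ih =>
    cases x with
    | none =>
      obtain ⟨m, h₁, h₂⟩ := ih hv
      exact ⟨m, .cons mem fire h₁, h₂⟩
    | some x =>
      cases u with
      | nil =>
        simp only [List.nil_append] at hv
        subst hv
        exact ⟨μ, .nil μ, .cons mem fire rest⟩
      | cons y u =>
        simp only [Option.toList_some, List.cons_append, List.nil_append,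
          List.cons.injEq] at hv
        obtain ⟨rfl, hv⟩ := hv
        obtain ⟨m, h₁, h₂⟩ := ih hv
        exact ⟨m, .cons mem fire h₁, h₂⟩

/-- A silent move of a Petri net. -/
def PetriNet.SilentStep (N : PetriNet X d) (a b : Fin d → ℕ) : Prop :=
  ∃ ν, (none, ν) ∈ N.transitions ∧ ∀ i, (b i : ℤ) = a i + ν i

theorem PetriNet.run_nil_iff {a b : Fin d → ℕ} :
    N.Run a [] b ↔ Relation.ReflTransGen N.SilentStep a b := by
  constructor
  · intro h
    generalize hv : ([] : List X) = v at h
    induction h with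
    | nil => exact .refl
    | @cons μ μ₁ μ' x ν v mem fire _ ih =>
      cases x with
      | none => exact .head ⟨ν, mem, fire⟩ (ih hv)
      | some x => simp at hv
  · intro h
    induction h using Relation.ReflTransGen.head_induction_on with
    | refl => exact .nil _
    | head h _ ih => exact .cons h.choose_spec.1 h.choose_spec.2 ih

theorem PetriNet.run_singleton_iff {a b : Fin d → ℕ} {x : X} :
    N.Run a [x] b ↔ ∃ m m' ν, Relation.ReflTransGen N.SilentStep a m ∧
      (some x, ν) ∈ N.transitions ∧ (∀ i, (m' i : ℤ) = m i + ν i) ∧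
      Relation.ReflTransGen N.SilentStep m' b := by
  constructor
  · intro h
    generalize hv : [x] = v at h
    induction h with
    | nil => simp at hv
    | @cons μ μ₁ μ' y ν v mem fire rest ih =>
      cases y with
      | none =>
        obtain ⟨m, m', ν', h₁, h₂, h₃, h₄⟩ := ih hv
        exact ⟨m, m', ν', .head ⟨ν, mem, fire⟩ h₁, h₂, h₃, h₄⟩
      | some y =>
        simp only [Option.toList_some, List.cons_append, List.nil_append,
          List.cons.injEq] at hv
        obtain ⟨rfl, rfl⟩ := hv
        exact ⟨μ, μ₁, ν, .refl, mem, fire, run_nil_iff.1 rest⟩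
  · rintro ⟨m, m', ν, h₁, h₂, h₃, h₄⟩
    exact Run.append (run_nil_iff.2 h₁) (.cons h₂ h₃ (run_nil_iff.2 h₄))

end FiringSequences

/-! ### Derivations along firing sequences -/

/-- The data of a grammar in Chomsky normal form and a Petri net that read the same letters.
`nils` and `bins` are the productions without terminals, `leaves` joins the terminal productions
with the transitions for that letter and the image of the letter, and `silent` lists the effects of
the silent transitions. Derivation trees of Horton–Strahler number at most `top` are considered. -/
structure NetGrammar (N Y : Type*) where
  dim : ℕ
  top : ℕ
  start : N
  nils : List N
  leaves : List (N × List Y × List ℤ)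
  bins : List (N × N × N)
  silent : List (List ℤ)
  initMarking : List ℕ
  final : List (List ℕ)

namespace NetGrammar

variable {N Y : Type*} (S : NetGrammar N Y)

/-- The addition of a vector to a marking. -/
def Fire (ν : List ℤ) (a b : Fin S.dim → ℕ) : Prop :=
  ∀ i, (b i : ℤ) = a i + vectorOfList S.dim ν i

/-- Sequences of silent moves. -/
def Silent : (Fin S.dim → ℕ) → (Fin S.dim → ℕ) → Prop :=
  Relation.ReflTransGen fun a b => ∃ ν ∈ S.silent, S.Fire ν a b

/-- `S.Der l A a b v`: some word with a derivation tree of root `A` and Horton–Strahler number at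
most `l` leads from marking `a` to marking `b`, and its image has the letters `v`. -/
inductive Der : ℕ → N → (Fin S.dim → ℕ) → (Fin S.dim → ℕ) → Multiset Y → Prop
  | nil {l : ℕ} {A : N} {a b : Fin S.dim → ℕ} (mem : A ∈ S.nils) (h : S.Silent a b) :
      Der l A a b 0
  | leaf {l : ℕ} {A : N} {u : List Y} {ν : List ℤ} {a m m' b : Fin S.dim → ℕ}
      (mem : (A, u, ν) ∈ S.leaves) (h₁ : S.Silent a m) (fire : S.Fire ν m m')
      (h₂ : S.Silent m' b) : Der l A a b u
  | right {l : ℕ} {A B C : N} {a m b : Fin S.dim → ℕ} {v v' : Multiset Y}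
      (mem : (A, B, C) ∈ S.bins) (hB : Der (l + 1) B a m v) (hC : Der l C m b v') :
      Der (l + 1) A a b (v + v')
  | left {l : ℕ} {A B C : N} {a m b : Fin S.dim → ℕ} {v v' : Multiset Y}
      (mem : (A, B, C) ∈ S.bins) (hB : Der l B a m v) (hC : Der (l + 1) C m b v') :
      Der (l + 1) A a b (v + v')

variable {S}

theorem Fire.add_left {ν : List ℤ} {a b : Fin S.dim → ℕ} (h : S.Fire ν a b)
    (o : Fin S.dim → ℕ) : S.Fire ν (o + a) (o + b) := fun i => by
  have := h i
  simp only [Pi.add_apply, Nat.cast_add]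
  omega

theorem Silent.add_left {a b : Fin S.dim → ℕ} (h : S.Silent a b) (o : Fin S.dim → ℕ) :
    S.Silent (o + a) (o + b) := by
  induction h with
  | refl => exact .refl
  | tail _ h ih =>
    obtain ⟨ν, hν, h⟩ := h
    exact ih.tail ⟨ν, hν, h.add_left o⟩

theorem Der.add_left {l : ℕ} {A : N} {a b : Fin S.dim → ℕ} {v : Multiset Y}
    (h : S.Der l A a b v) (o : Fin S.dim → ℕ) : S.Der l A (o + a) (o + b) v := by
  induction h with
  | nil mem h => exact .nil mem (h.add_left o)
  | leaf mem h₁ fire h₂ => exact .leaf mem (h₁.add_left o) (fire.add_left o) (h₂.add_left o)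
  | right mem _ _ hB hC => exact .right mem hB hC
  | left mem _ _ hB hC => exact .left mem hB hC

theorem Der.trans_silent {l : ℕ} {A : N} {a b b' : Fin S.dim → ℕ} {v : Multiset Y}
    (h : S.Der l A a b v) (hb : S.Silent b b') : S.Der l A a b' v := by
  induction h with
  | nil mem h => exact .nil mem (h.trans hb)
  | leaf mem h₁ fire h₂ => exact .leaf mem h₁ fire (h₂.trans hb)
  | right mem hB _ _ hC => exact .right mem hB (hC hb)
  | left mem hB _ _ hC => exact .left mem hB (hC hb)

/-- The Parikh images (as multisets) that are described by `S`. -/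
def images (S : NetGrammar N Y) : Set (Multiset Y) :=
  {v | ∃ f ∈ S.final,
    S.Der S.top S.start (vectorOfList S.dim S.initMarking) (vectorOfList S.dim f) v}

/-- `S` describes the intersection of a finite-index language with a Petri net language, and its
image under `h`. -/
structure Represents {X : Type} (G : ContextFreeGrammar.{0} X) (S : NetGrammar G.NT Y)
    (P : PetriNet X S.dim) (h : X → List Y) : Prop where
  start : S.start = G.initial
  initMarking : vectorOfList S.dim S.initMarking = P.initial
  final : ∀ f, f ∈ P.final ↔ ∃ l ∈ S.final, vectorOfList S.dim l = f
  nils : ∀ A, A ∈ S.nils ↔ ContextFreeRule.mk A [] ∈ G.rules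
  bins : ∀ A B C, (A, B, C) ∈ S.bins ↔
    ContextFreeRule.mk A [Symbol.nonterminal B, Symbol.nonterminal C] ∈ G.rules
  silent : ∀ ν, (none, ν) ∈ P.transitions ↔ ∃ l ∈ S.silent, vectorOfList S.dim l = ν
  of_leaves : ∀ A u l, (A, u, l) ∈ S.leaves →
    ∃ x, ContextFreeRule.mk A [Symbol.terminal x] ∈ G.rules ∧
      (some x, vectorOfList S.dim l) ∈ P.transitions ∧ h x = u
  leaves : ∀ A x ν, ContextFreeRule.mk A [Symbol.terminal x] ∈ G.rules →
    (some x, ν) ∈ P.transitions → ∃ l, vectorOfList S.dim l = ν ∧ (A, h x, l) ∈ S.leaves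

section Represents

variable {X : Type} {G : ContextFreeGrammar.{0} X} {S : NetGrammar G.NT Y}
  {P : PetriNet X S.dim} {h : X → List Y}

theorem Represents.silent_iff (hS : S.Represents G P h) {a b : Fin S.dim → ℕ} :
    S.Silent a b ↔ Relation.ReflTransGen P.SilentStep a b := by
  have : P.SilentStep = fun a b => ∃ ν ∈ S.silent, S.Fire ν a b := by
    ext a b
    constructor
    · rintro ⟨ν, hν, hf⟩
      obtain ⟨l, hl, rfl⟩ := (hS.silent ν).1 hν
      exact ⟨l, hl, hf⟩
    · rintro ⟨l, hl, hf⟩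
      exact ⟨_, (hS.silent _).2 ⟨l, hl, rfl⟩, hf⟩
  rw [this, Silent]

theorem Represents.der_iff (hS : S.Represents G P h) {l : ℕ} {A : G.NT}
    {a b : Fin S.dim → ℕ} {v : Multiset Y} :
    S.Der l A a b v ↔
      ∃ w, StrahlerDerivation G l A w ∧ P.Run a w b ∧ (w.flatMap h : Multiset Y) = v := by
  constructor
  · intro hd
    induction hd with
    | nil mem hs =>
      exact ⟨[], .nil _ ((hS.nils _).1 mem), PetriNet.run_nil_iff.2 (hS.silent_iff.1 hs), by simp⟩
    | leaf mem h₁ fire h₂ =>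
      obtain ⟨x, hx, ht, rfl⟩ := hS.of_leaves _ _ _ mem
      exact ⟨[x], .leaf _ hx, PetriNet.run_singleton_iff.2 ⟨_, _, _, hS.silent_iff.1 h₁, ht, fire,
        hS.silent_iff.1 h₂⟩, by simp⟩
    | right mem _ _ hB hC =>
      obtain ⟨u, hu, hru, rfl⟩ := hB
      obtain ⟨w, hw, hrw, rfl⟩ := hC
      exact ⟨u ++ w, .right ((hS.bins _ _ _).1 mem) hu hw, hru.append hrw, by simp⟩
    | left mem _ _ hB hC =>
      obtain ⟨u, hu, hru, rfl⟩ := hB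
      obtain ⟨w, hw, hrw, rfl⟩ := hC
      exact ⟨u ++ w, .left ((hS.bins _ _ _).1 mem) hu hw, hru.append hrw, by simp⟩
  · rintro ⟨w, hw, hr, rfl⟩
    induction hw generalizing a b with
    | nil _ mem => exact .nil ((hS.nils _).2 mem) (hS.silent_iff.2 (PetriNet.run_nil_iff.1 hr))
    | leaf _ mem =>
      obtain ⟨m, m', ν, h₁, h₂, h₃, h₄⟩ := PetriNet.run_singleton_iff.1 hr
      obtain ⟨l, rfl, hl⟩ := hS.leaves _ _ _ mem h₂
      simpa using Der.leaf hl (hS.silent_iff.2 h₁) h₃ (hS.silent_iff.2 h₄)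
    | right mem _ _ ihB ihC =>
      obtain ⟨m, h₁, h₂⟩ := hr.exists_of_append
      rw [List.flatMap_append, ← Multiset.coe_add]
      exact .right ((hS.bins _ _ _).2 mem) (ihB h₁) (ihC h₂)
    | left mem _ _ ihB ihC =>
      obtain ⟨m, h₁, h₂⟩ := hr.exists_of_append
      rw [List.flatMap_append, ← Multiset.coe_add]
      exact .left ((hS.bins _ _ _).2 mem) (ihB h₁) (ihC h₂)

theorem Represents.mem_images_iff (hS : S.Represents G P h) (hG : IsChomskyNF G)
    {v : Multiset Y} : v ∈ S.images ↔
      ∃ w ∈ morphicIntersection h (approximation G (S.top + 1)) P.language,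
        (w : Multiset Y) = v := by
  constructor
  · rintro ⟨f, hf, hd⟩
    obtain ⟨w, hw, hr, rfl⟩ := hS.der_iff.1 hd
    rw [hS.start] at hw
    rw [hS.initMarking] at hr
    exact ⟨_, ⟨w, (mem_approximation_succ_iff hG).2 hw, ⟨_, (hS.final _).2 ⟨f, hf, rfl⟩, hr⟩, rfl⟩,
      rfl⟩
  · rintro ⟨_, ⟨w, hw, ⟨μ, hμ, hr⟩, rfl⟩, rfl⟩
    obtain ⟨f, hf, rfl⟩ := (hS.final _).1 hμ
    refine ⟨f, hf, hS.der_iff.2 ⟨w, ?_, ?_, rfl⟩⟩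
    · rw [hS.start]
      exact (mem_approximation_succ_iff hG).1 hw
    · rw [hS.initMarking]
      exact hr

end Represents

end NetGrammar

/-! ### A structured counter machine -/

namespace NetGrammar

variable {N Y : Type*}

/-- A binary production under evaluation. The derivation from the child `spine` is present and the
one from the child `callee` is being computed. If `side`, the callee is the second child and its
derivation starts where the one from the spine ends, that is, at the right marking of the spine;
otherwise it is the first child and ends at the left marking of the spine. -/
structure Pending (N : Type*) where
  side : Bool
  lhs : N
  spine : N
  callee : N

/-- The production `(A, B, C)`, meaning `A → BC`, of a pending production. -/
def Pending.rule (p : Pending N) : N × N × N :=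
  if p.side then (p.lhs, p.spine, p.callee) else (p.lhs, p.callee, p.spine)

/-- What the machine does: `idle` before the production at a leaf of the derivation tree is chosen,
`done A` when a derivation from `A` is present, `take` and `put` while the derivation from the
callee of the topmost pending production is attached to the one from its spine. -/
inductive Mode (N : Type*)
  | idle
  | done (A : N)
  | take
  | put

/-- Control states: a mode and a stack of pending productions, or `none`, the final state. -/
abbrev Control (N : Type*) := Option (Mode N × List (Pending N))

/-- Operations on counters: integer vectors, to be added to the marking with the given level and
side. The left marking has side `false`, the right one has side `true`. -/
abbrev Op := List (ℕ × Bool × List ℤ)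

/-- Edges of the structured machine: source, word, number of levels that are tested for zero,
operation, target. -/
abbrev Edge (N Y : Type*) := Control N × List Y × ℕ × Op × Control N

/-- The operation that removes the tokens `sub` and adds the tokens `add`. -/
def transferOp (sub add : List (ℕ × Bool × List ℕ)) : Op :=
  sub.map (fun e => (e.1, e.2.1, e.2.2.map fun n : ℕ => -(n : ℤ))) ++
    add.map fun e => (e.1, e.2.1, e.2.2.map Nat.cast)

/-- The addition of `ν` to the right marking of level `l`. -/
def fireOp (l : ℕ) (ν : List ℤ) : Op := [(l, true, ν)]

/-- The `i`-th unit vector. -/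
def unitList (i : ℕ) : List ℕ := List.replicate i 0 ++ [1]

/-- A token on coordinate `i` of both markings of level `l`: the empty firing sequence may start
anywhere. -/
def guessOp (l i : ℕ) : Op :=
  transferOp [] [(l, false, unitList i), (l, true, unitList i)]

/-- Cancels a token at which the derivation from a callee (level `l`) meets the derivation from
its spine (level `l + 1`). -/
def takeOp (l : ℕ) (s : Bool) (i : ℕ) : Op :=
  transferOp [(l, !s, unitList i), (l + 1, s, unitList i)] []

/-- Moves a token at the other end of the derivation from a callee to the level of the spine. -/
def putOp (l : ℕ) (s : Bool) (i : ℕ) : Op :=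
  transferOp [(l, s, unitList i)] [(l + 1, s, unitList i)]

section Edges

variable (S : NetGrammar N Y)

/-- The productions that can be pending: either child may be the callee. -/
def pendings : List (Pending N) :=
  S.bins.flatMap fun b => [⟨true, b.1, b.2.1, b.2.2⟩, ⟨false, b.1, b.2.2, b.2.1⟩]

/-- The stacks of `m` pending productions. -/
def pendingStacks (m : ℕ) : List (List (Pending N)) :=
  Nat.rec [[]] (fun _ L => S.pendings.flatMap fun p => L.map fun r => p :: r) m

/-- The modes in which silent transitions are fired. -/
def silentModes : List (Mode N) := .idle :: S.leaves.map fun e => .done e.1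

/-- The edges that construct a derivation of a single leaf at level `l`. -/
def leafEdges (l : ℕ) (r : List (Pending N)) : List (Edge N Y) :=
  ((List.range S.dim).map fun i => (some (.idle, r), [], 0, guessOp l i, some (.idle, r))) ++
  (S.silentModes.flatMap fun m =>
    S.silent.map fun ν => (some (m, r), [], 0, fireOp l ν, some (m, r))) ++
  (S.nils.map fun A => (some (.idle, r), [], 0, [], some (.done A, r))) ++
  S.leaves.map fun e => (some (.idle, r), e.2.1, 0, fireOp l e.2.2, some (.done e.1, r))

/-- The edges that compute the callee of `p` at level `l` and attach it to the spine at level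
`l + 1`. The last edge, which tests the levels up to `l`, checks that all of it is attached. -/
def callEdges (l : ℕ) (p : Pending N) (r : List (Pending N)) : List (Edge N Y) :=
  [(some (.done p.spine, r), [], 0, [], some (.idle, p :: r)),
    (some (.done p.callee, p :: r), [], 0, [], some (.take, p :: r)),
    (some (.take, p :: r), [], 0, [], some (.put, p :: r)),
    (some (.put, p :: r), [], l + 1, [], some (.done p.lhs, r))] ++
  ((List.range S.dim).map fun i =>
    (some (.take, p :: r), [], 0, takeOp l p.side i, some (.take, p :: r))) ++
  (List.range S.dim).map fun i =>
    (some (.put, p :: r), [], 0, putOp l p.side i, some (.put, p :: r))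

/-- The edges that accept, by removing the initial marking and a final marking from the left and the
right marking of the top level. -/
def finalEdges : List (Edge N Y) :=
  S.final.map fun f => (some (.done S.start, []), [], 0,
    transferOp [(S.top, false, S.initMarking), (S.top, true, f)] [], none)

/-- The edges at level `l` that look at the stack of pending productions. -/
def stackEdges (l : ℕ) : List (Pending N) → List (Edge N Y)
  | [] => S.finalEdges
  | p :: r => S.callEdges l p r

/-- All edges. Level `l` is used when `S.top - l` productions are pending. -/
def edges : List (Edge N Y) :=
  (List.range (S.top + 1)).flatMap fun m => (S.pendingStacks m).flatMap fun r =>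
    S.leafEdges (S.top - m) r ++ S.stackEdges (S.top - m) r

/-- The stack `r` of pending productions may occur while level `l` is in use. -/
def IsStackAt (l : ℕ) (r : List (Pending N)) : Prop :=
  l + r.length = S.top ∧ ∀ p ∈ r, p.rule ∈ S.bins

/-- The edges of the structured machine, by their purpose. -/
inductive EdgeAt (l : ℕ) : List (Pending N) → Edge N Y → Prop
  | guess {r : List (Pending N)} {i : ℕ} (hi : i < S.dim) :
      EdgeAt l r (some (.idle, r), [], 0, guessOp l i, some (.idle, r))
  | silent {r : List (Pending N)} {m : Mode N} {ν : List ℤ} (hm : m ∈ S.silentModes)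
      (hν : ν ∈ S.silent) : EdgeAt l r (some (m, r), [], 0, fireOp l ν, some (m, r))
  | nil {r : List (Pending N)} {A : N} (hA : A ∈ S.nils) :
      EdgeAt l r (some (.idle, r), [], 0, [], some (.done A, r))
  | leaf {r : List (Pending N)} {A : N} {u : List Y} {ν : List ℤ} (mem : (A, u, ν) ∈ S.leaves) :
      EdgeAt l r (some (.idle, r), u, 0, fireOp l ν, some (.done A, r))
  | final {f : List ℕ} (hf : f ∈ S.final) :
      EdgeAt l [] (some (.done S.start, []), [], 0,
        transferOp [(S.top, false, S.initMarking), (S.top, true, f)] [], none)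
  | call {p : Pending N} {r : List (Pending N)} :
      EdgeAt l (p :: r) (some (.done p.spine, r), [], 0, [], some (.idle, p :: r))
  | beginTake {p : Pending N} {r : List (Pending N)} :
      EdgeAt l (p :: r) (some (.done p.callee, p :: r), [], 0, [], some (.take, p :: r))
  | beginPut {p : Pending N} {r : List (Pending N)} :
      EdgeAt l (p :: r) (some (.take, p :: r), [], 0, [], some (.put, p :: r))
  | finish {p : Pending N} {r : List (Pending N)} :
      EdgeAt l (p :: r) (some (.put, p :: r), [], l + 1, [], some (.done p.lhs, r))
  | take {p : Pending N} {r : List (Pending N)} {i : ℕ} (hi : i < S.dim) :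
      EdgeAt l (p :: r) (some (.take, p :: r), [], 0, takeOp l p.side i, some (.take, p :: r))
  | put {p : Pending N} {r : List (Pending N)} {i : ℕ} (hi : i < S.dim) :
      EdgeAt l (p :: r) (some (.put, p :: r), [], 0, putOp l p.side i, some (.put, p :: r))

end Edges

variable {S : NetGrammar N Y}

theorem mem_pendings {p : Pending N} : p ∈ S.pendings ↔ p.rule ∈ S.bins := by
  obtain ⟨s, A, B, C⟩ := p
  cases s <;> simp [pendings, Pending.rule]

theorem mem_pendingStacks {m : ℕ} {r : List (Pending N)} :
    r ∈ S.pendingStacks m ↔ r.length = m ∧ ∀ p ∈ r, p.rule ∈ S.bins := by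
  induction m generalizing r with
  | zero => cases r <;> simp [pendingStacks]
  | succ m ih =>
    have : S.pendingStacks (m + 1) =
      S.pendings.flatMap fun p => (S.pendingStacks m).map fun r => p :: r := rfl
    cases r <;> simp [this, mem_pendings, ih, and_left_comm]

theorem mem_leafEdges_append_stackEdges {l : ℕ} {r : List (Pending N)} {e : Edge N Y} :
    e ∈ S.leafEdges l r ++ S.stackEdges l r ↔ S.EdgeAt l r e := by
  constructor
  · intro h
    simp only [leafEdges, List.mem_append, List.mem_map, List.mem_range, List.mem_flatMap] at h
    rcases h with (((⟨i, hi, rfl⟩ | ⟨m, hm, ν, hν, rfl⟩) | ⟨A, hA, rfl⟩) | ⟨e, he, rfl⟩) | h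
    · exact .guess hi
    · exact .silent hm hν
    · exact .nil hA
    · exact .leaf he
    · cases r with
      | nil =>
        obtain ⟨f, hf, rfl⟩ := List.mem_map.1 h
        exact .final hf
      | cons p r =>
        simp only [stackEdges, callEdges, List.mem_append, List.mem_map, List.mem_range,
          List.mem_cons, List.not_mem_nil, or_false] at h
        rcases h with ((rfl | rfl | rfl | rfl) | ⟨i, hi, rfl⟩) | ⟨i, hi, rfl⟩ <;>
          constructor <;> assumption
  · rintro (_ | _ | _ | _ | _ | _ | _ | _ | _ | _ | _) <;>
      grind [leafEdges, stackEdges, finalEdges, callEdges]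

theorem mem_edges {e : Edge N Y} :
    e ∈ S.edges ↔ ∃ l r, S.IsStackAt l r ∧ S.EdgeAt l r e := by
  simp only [edges, List.mem_flatMap, List.mem_range, mem_pendingStacks,
    mem_leafEdges_append_stackEdges]
  constructor
  · rintro ⟨m, hm, r, ⟨rfl, hr⟩, h⟩
    exact ⟨_, r, ⟨by omega, hr⟩, h⟩
  · rintro ⟨l, r, ⟨hl, hr⟩, h⟩
    exact ⟨r.length, by omega, r, ⟨rfl, hr⟩, by rwa [← hl, Nat.add_sub_cancel_right]⟩

/-- Counter values, by level, side and coordinate. -/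
abbrev Counters (S : NetGrammar N Y) := ℕ → Bool → Fin S.dim → ℕ

/-- The counters with a given marking on side `s` of level `l`, and zero elsewhere. -/
def place {R ι : Type*} [AddMonoid R] (l : ℕ) (s : Bool) : (ι → R) →+ (ℕ → Bool → ι → R) :=
  (AddMonoidHom.single (fun _ => Bool → ι → R) l).comp (AddMonoidHom.single (fun _ => ι → R) s)

/-- The counters with the given tokens. -/
def placeAll {R : Type*} [AddMonoid R] (d : ℕ) (L : List (ℕ × Bool × List R)) :
    ℕ → Bool → Fin d → R :=
  (L.map fun e => place e.1 e.2.1 (vectorOfList d e.2.2)).sum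

/-- The operation `o` leads from `c` to `c'`. -/
def Acts (S : NetGrammar N Y) (o : Op) (c c' : S.Counters) : Prop :=
  ∀ l s i, (c' l s i : ℤ) = c l s i + placeAll S.dim o l s i

/-- Runs of the structured machine, with the letters that are read. -/
inductive MRun (S : NetGrammar N Y) :
    Control N → S.Counters → Multiset Y → Control N → S.Counters → Prop
  | refl (p : Control N) (c : S.Counters) : MRun S p c 0 p c
  | head {p p₁ q : Control N} {c c₁ c' : S.Counters} {u : List Y} {v : Multiset Y} {j : ℕ}
      {o : Op} (mem : (p, u, j, o, p₁) ∈ S.edges) (test : ∀ l < j, c l = 0)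
      (acts : S.Acts o c c₁) (rest : MRun S p₁ c₁ v q c') : MRun S p c (u + v) q c'

theorem MRun.trans {p q r : Control N} {c c' c'' : S.Counters} {v v' : Multiset Y}
    (h : S.MRun p c v q c') (h' : S.MRun q c' v' r c'') : S.MRun p c (v + v') r c'' := by
  induction h with
  | refl => simpa using h'
  | head mem test acts _ ih =>
    rw [add_assoc]
    exact .head mem test acts (ih h')

theorem place_apply {R ι : Type*} [AddMonoid R] (l : ℕ) (s : Bool) (x : ι → R) (l' : ℕ)
    (s' : Bool) : place l s x l' s' = if l' = l ∧ s' = s then x else 0 := by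
  by_cases hl : l' = l
  · subst hl
    simp [place, Pi.single_apply]
  · simp [place, hl]

theorem place_of_ne {R ι : Type*} [AddMonoid R] {l l' : ℕ} (h : l' ≠ l) (s : Bool) (x : ι → R) :
    place l s x l' = 0 :=
  Pi.single_eq_of_ne h _

theorem vectorOfList_map {R R' : Type*} [Zero R] [Zero R'] (f : R → R') (hf : f 0 = 0) (d : ℕ)
    (L : List R) : vectorOfList d (L.map f) = f ∘ vectorOfList d L := by
  funext i
  simp only [vectorOfList, Function.comp_apply]
  rw [← hf, List.getD_map]

theorem vectorOfList_unitList {d : ℕ} (i : Fin d) :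
    vectorOfList d (unitList i) = Pi.single i 1 := by
  funext j
  simp only [vectorOfList, unitList, List.getD_eq_getElem?_getD, Pi.single_apply, Fin.ext_iff]
  rcases lt_trichotomy (j : ℕ) i with h | h | h
  · rw [List.getElem?_append_left (by simpa using h)]
    simp [h, h.ne]
  · simp [h]
  · rw [List.getElem?_eq_none (by simpa using h)]
    simp [h.ne']

theorem placeAll_append {R : Type*} [AddMonoid R] (d : ℕ) (L L' : List (ℕ × Bool × List R)) :
    placeAll d (L ++ L') = placeAll d L + placeAll d L' := by
  simp [placeAll]

theorem placeAll_map {R R' : Type*} [AddMonoid R] [AddMonoid R'] (f : R →+ R') (d : ℕ)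
    (L : List (ℕ × Bool × List R)) (l : ℕ) (s : Bool) (i : Fin d) :
    placeAll d (L.map fun e => (e.1, e.2.1, e.2.2.map f)) l s i = f (placeAll d L l s i) := by
  induction L with
  | nil => simp [placeAll]
  | cons e L ih =>
    simp only [placeAll, List.map_cons, List.sum_cons, Pi.add_apply, map_add] at ih ⊢
    rw [ih, vectorOfList_map f (map_zero f), place_apply, place_apply]
    split_ifs <;> simp

theorem acts_transferOp {sub add : List (ℕ × Bool × List ℕ)} {c c' : S.Counters} :
    S.Acts (transferOp sub add) c c' ↔ c' + placeAll S.dim sub = c + placeAll S.dim add := by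
  have hsub : ∀ l s i, placeAll S.dim
      (sub.map fun e => (e.1, e.2.1, e.2.2.map fun n : ℕ => -(n : ℤ))) l s i =
        -((placeAll S.dim sub l s i : ℕ) : ℤ) := placeAll_map (-Nat.castAddMonoidHom ℤ) S.dim sub
  have hadd : ∀ l s i, placeAll S.dim (add.map fun e => (e.1, e.2.1, e.2.2.map Nat.cast)) l s i =
      ((placeAll S.dim add l s i : ℕ) : ℤ) := placeAll_map (Nat.castAddMonoidHom ℤ) S.dim add
  simp only [Acts, transferOp, placeAll_append, Pi.add_apply, funext_iff, hsub, hadd]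
  refine forall₃_congr fun l s i => ?_
  omega

theorem acts_fireOp {l : ℕ} {ν : List ℤ} {c c' : S.Counters} :
    S.Acts (fireOp l ν) c c' ↔
      (∀ l' s, ¬(l' = l ∧ s = true) → c' l' s = c l' s) ∧ S.Fire ν (c l true) (c' l true) := by
  simp only [Acts, fireOp, placeAll, List.map_cons, List.map_nil, List.sum_singleton, place_apply]
  constructor
  · intro h
    refine ⟨fun l' s hs => funext fun i => ?_, fun i => by simpa using h l true i⟩
    simpa [hs] using h l' s i
  · rintro ⟨h, hf⟩ l' s i
    by_cases hs : l' = l ∧ s = true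
    · obtain ⟨rfl, rfl⟩ := hs
      simpa using hf i
    · simp [hs, h l' s hs]

theorem acts_nil {c c' : S.Counters} : S.Acts [] c c' ↔ c' = c := by
  simp [Acts, placeAll, funext_iff]

theorem acts_guessOp {l : ℕ} {i : Fin S.dim} {c c' : S.Counters} :
    S.Acts (guessOp l i) c c' ↔
      c' = c + (place l false (Pi.single i 1) + place l true (Pi.single i 1)) := by
  simp [guessOp, acts_transferOp, placeAll, vectorOfList_unitList]

theorem acts_takeOp {l : ℕ} {s : Bool} {i : Fin S.dim} {c c' : S.Counters} :
    S.Acts (takeOp l s i) c c' ↔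
      c' + (place l (!s) (Pi.single i 1) + place (l + 1) s (Pi.single i 1)) = c := by
  simp [takeOp, acts_transferOp, placeAll, vectorOfList_unitList]

theorem acts_putOp {l : ℕ} {s : Bool} {i : Fin S.dim} {c c' : S.Counters} :
    S.Acts (putOp l s i) c c' ↔
      c' + place l s (Pi.single i 1) = c + place (l + 1) s (Pi.single i 1) := by
  simp [putOp, acts_transferOp, placeAll, vectorOfList_unitList]

end NetGrammar

/-! ### Soundness of the structured machine -/

namespace NetGrammar

variable {N Y : Type*}

/-- A derivation between the two markings of a level. -/
def LevelDer (S : NetGrammar N Y) (l : ℕ) (A : N) (x : Bool → Fin S.dim → ℕ) (v : Multiset Y) :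
    Prop :=
  S.Der l A (x false) (x true) v

/-- The levels from `l` on hold derivations from the given nonterminals, which generate the
letters `v` altogether. -/
def Holds (S : NetGrammar N Y) : List N → ℕ → S.Counters → Multiset Y → Prop
  | [], _, _, v => v = 0
  | A :: As, l, c, v => ∃ v₁ v₂, v = v₁ + v₂ ∧ S.LevelDer l A (c l) v₁ ∧ S.Holds As (l + 1) c v₂

/-- The invariant of the mode `idle`, at level `l`, for a stack with the spines `As`. -/
def IdleInv (S : NetGrammar N Y) (As : List N) (l : ℕ) (c : S.Counters) (v : Multiset Y) : Prop :=
  (∀ l' < l, c l' = 0) ∧ S.Silent (c l false) (c l true) ∧ S.Holds As (l + 1) c v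

/-- The invariant of the modes `done`, at level `l`: the nonterminals `As` are the one that is done
and the spines of the stack. -/
def DoneInv (S : NetGrammar N Y) (As : List N) (l : ℕ) (c : S.Counters) (v : Multiset Y) : Prop :=
  (∀ l' < l, c l' = 0) ∧ S.Holds As l c v

/-- The invariant of the mode `take`, at level `l`: the tokens `x` have been taken so far. -/
def TakeInv (S : NetGrammar N Y) (p : Pending N) (As : List N) (l : ℕ) (c : S.Counters)
    (v : Multiset Y) : Prop :=
  ∃ x, S.DoneInv (p.callee :: p.spine :: As) l
    (c + (place l (!p.side) x + place (l + 1) p.side x)) v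

/-- The invariant of the mode `put`, at level `l`: the tokens `y` have been put so far. -/
def PutInv (S : NetGrammar N Y) (p : Pending N) (As : List N) (l : ℕ) (c : S.Counters)
    (v : Multiset Y) : Prop :=
  ∃ c₀ y, S.TakeInv p As l c₀ v ∧ c + place l p.side y = c₀ + place (l + 1) p.side y

/-- The invariant of a mode, at level `l`. -/
def ModeInv (S : NetGrammar N Y) :
    Mode N → List (Pending N) → ℕ → S.Counters → Multiset Y → Prop
  | .idle, r => S.IdleInv (r.map Pending.spine)
  | .done A, r => S.DoneInv (A :: r.map Pending.spine)
  | .take, p :: r => S.TakeInv p (r.map Pending.spine)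
  | .put, p :: r => S.PutInv p (r.map Pending.spine)
  | .take, [] | .put, [] => fun _ _ _ => False

/-- The invariant of the structured machine, after the letters `v` have been read. -/
def Inv (S : NetGrammar N Y) : Control N → S.Counters → Multiset Y → Prop
  | none, c, v => c = 0 → v ∈ S.images
  | some (m, r), c, v => ∃ l, l + r.length = S.top ∧ S.ModeInv m r l c v

variable {S : NetGrammar N Y} {As : List N} {r : List (Pending N)} {l : ℕ} {c c' : S.Counters}
  {v : Multiset Y}

theorem inv_some_iff {m : Mode N} (hr : l + r.length = S.top) :
    S.Inv (some (m, r)) c v ↔ S.ModeInv m r l c v := by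
  constructor
  · rintro ⟨l', hr', h⟩
    obtain rfl : l' = l := by omega
    exact h
  · exact fun h => ⟨l, hr, h⟩

theorem Holds.congr (h : S.Holds As l c v) (hc : ∀ l' ≥ l, c' l' = c l') : S.Holds As l c' v := by
  induction As generalizing l v with
  | nil => exact h
  | cons A As ih =>
    obtain ⟨v₁, v₂, rfl, hd, h⟩ := h
    exact ⟨v₁, v₂, rfl, by rwa [hc l le_rfl], ih h fun l' hl => hc l' (by omega)⟩

theorem LevelDer.attach {p : Pending N} {x y : Bool → Fin S.dim → ℕ} {o : Fin S.dim → ℕ}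
    {w : Multiset Y} (hp : p.rule ∈ S.bins) (hs : S.LevelDer (l + 1) p.spine x v)
    (hc : S.LevelDer l p.callee y w) (h : o + y (!p.side) = x p.side) :
    S.LevelDer (l + 1) p.lhs (Function.update x p.side (o + y p.side)) (v + w) := by
  obtain ⟨side, A, B, C⟩ := p
  replace hc : S.Der l C (o + y false) (o + y true) w := Der.add_left hc o
  cases side
  · rw [add_comm v w]
    refine .left hp hc ?_
    simpa [LevelDer, show o + y true = x false from h] using hs
  · refine .right hp hs ?_
    simpa [show o + y false = x true from h] using hc

theorem IdleInv.guess (h : S.IdleInv As l c v) {x : Fin S.dim → ℕ}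
    (hc : c' = c + (place l false x + place l true x)) : S.IdleInv As l c' v := by
  obtain ⟨h₀, hs, hr⟩ := h
  have hne (l') (hl : l' ≠ l) : c' l' = c l' := by simp [hc, place_of_ne hl]
  refine ⟨fun l' hl => by rw [hne l' hl.ne, h₀ l' hl], ?_, hr.congr fun l' hl => hne l' (by omega)⟩
  simpa [hc, place_apply, add_comm] using hs.add_left x

theorem IdleInv.silent (h : S.IdleInv As l c v) {ν : List ℤ} (hν : ν ∈ S.silent)
    (acts : S.Acts (fireOp l ν) c c') : S.IdleInv As l c' v := by
  obtain ⟨h₀, hs, hr⟩ := h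
  obtain ⟨hc, hf⟩ := acts_fireOp.1 acts
  have hne (l') (hl : l' ≠ l) : c' l' = c l' := funext fun s => hc l' s (by simp [hl])
  refine ⟨fun l' hl => by rw [hne l' hl.ne, h₀ l' hl], ?_, hr.congr fun l' hl => hne l' (by omega)⟩
  rw [hc l false (by simp)]
  exact hs.tail ⟨ν, hν, hf⟩

theorem DoneInv.silent {A : N} (h : S.DoneInv (A :: As) l c v) {ν : List ℤ} (hν : ν ∈ S.silent)
    (acts : S.Acts (fireOp l ν) c c') : S.DoneInv (A :: As) l c' v := by
  obtain ⟨h₀, v₁, v₂, rfl, hd, hr⟩ := h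
  obtain ⟨hc, hf⟩ := acts_fireOp.1 acts
  have hne (l') (hl : l' ≠ l) : c' l' = c l' := funext fun s => hc l' s (by simp [hl])
  refine ⟨fun l' hl => by rw [hne l' hl.ne, h₀ l' hl], v₁, v₂, rfl, ?_,
    hr.congr fun l' hl => hne l' (by omega)⟩
  rw [LevelDer, hc l false (by simp)]
  exact Der.trans_silent hd (.single ⟨ν, hν, hf⟩)

theorem IdleInv.nil (h : S.IdleInv As l c v) {A : N} (hA : A ∈ S.nils) :
    S.DoneInv (A :: As) l c v := by
  obtain ⟨h₀, hs, hr⟩ := h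
  exact ⟨h₀, 0, v, (zero_add v).symm, .nil hA hs, hr⟩

theorem IdleInv.leaf (h : S.IdleInv As l c v) {A : N} {u : List Y} {ν : List ℤ}
    (mem : (A, u, ν) ∈ S.leaves) (acts : S.Acts (fireOp l ν) c c') :
    S.DoneInv (A :: As) l c' (v + u) := by
  obtain ⟨h₀, hs, hr⟩ := h
  obtain ⟨hc, hf⟩ := acts_fireOp.1 acts
  have hne (l') (hl : l' ≠ l) : c' l' = c l' := funext fun s => hc l' s (by simp [hl])
  refine ⟨fun l' hl => by rw [hne l' hl.ne, h₀ l' hl], u, v, add_comm _ _, ?_,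
    hr.congr fun l' hl => hne l' (by omega)⟩
  rw [LevelDer, hc l false (by simp)]
  exact .leaf mem hs hf .refl

theorem DoneInv.call {A : N} (h : S.DoneInv (A :: As) (l + 1) c v) : S.IdleInv (A :: As) l c v := by
  obtain ⟨h₀, hr⟩ := h
  refine ⟨fun l' hl => h₀ l' (by omega), ?_, hr⟩
  rw [h₀ l (by omega)]
  exact .refl

theorem DoneInv.beginTake {p : Pending N} (h : S.DoneInv (p.callee :: p.spine :: As) l c v) :
    S.TakeInv p As l c v :=
  ⟨0, by simpa only [map_zero, add_zero] using h⟩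

theorem TakeInv.take {p : Pending N} (h : S.TakeInv p As l c v) {z : Fin S.dim → ℕ}
    (hc : c' + (place l (!p.side) z + place (l + 1) p.side z) = c) : S.TakeInv p As l c' v := by
  subst hc
  obtain ⟨x, h⟩ := h
  refine ⟨z + x, ?_⟩
  rwa [map_add, map_add, add_add_add_comm, ← add_assoc]

theorem TakeInv.beginPut {p : Pending N} (h : S.TakeInv p As l c v) : S.PutInv p As l c v :=
  ⟨c, 0, h, by simp only [map_zero]⟩

theorem PutInv.put {p : Pending N} (h : S.PutInv p As l c v) {z : Fin S.dim → ℕ}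
    (hc : c' + place l p.side z = c + place (l + 1) p.side z) : S.PutInv p As l c' v := by
  obtain ⟨c₀, y, h, hy⟩ := h
  refine ⟨c₀, y + z, h, ?_⟩
  rw [map_add, map_add, ← add_assoc c₀, ← hy, add_right_comm c, ← hc,
    add_right_comm c', add_assoc]

theorem PutInv.finish {p : Pending N} (hp : p.rule ∈ S.bins) (h : S.PutInv p As l c v)
    (test : ∀ l' < l + 1, c l' = 0) : S.DoneInv (p.lhs :: As) (l + 1) c v := by
  obtain ⟨c₀, y, ⟨x, -, v₁, _, rfl, hd₁, v₂, v₃, rfl, hd₂, hr⟩, hy⟩ := h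
  have hc (l' s) : c l' s + (place l p.side y : S.Counters) l' s =
      c₀ l' s + (place (l + 1) p.side y : S.Counters) l' s := congr_fun₂ hy l' s
  refine ⟨test, v₂ + v₁, v₃, by abel, ?_, hr.congr fun l' hl => funext fun s => ?_⟩
  · have hlow : c₀ l = Pi.single p.side y := by
      funext s
      simpa [place_apply, test l, Pi.single_apply, eq_comm] using hc l s
    have hspine : c (l + 1) = c₀ (l + 1) + Pi.single p.side y := by
      funext s
      simpa [place_apply, Pi.single_apply] using hc (l + 1) s
    have hd := hd₂.attach hp hd₁ (o := c₀ (l + 1) p.side) (by simp [place_apply, hlow])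
    convert hd using 1
    funext s
    by_cases hs : s = p.side <;> simp [hs, hspine, hlow, place_apply]
  · have hl₁ : l' ≠ l := by omega
    have hl₂ : l' ≠ l + 1 := by omega
    simpa [place_of_ne hl₁, place_of_ne hl₂] using hc l' s

theorem DoneInv.mem_images (h : S.DoneInv [S.start] S.top c v) {f : List ℕ} (hf : f ∈ S.final)
    (hc : c = place S.top false (vectorOfList S.dim S.initMarking) +
      place S.top true (vectorOfList S.dim f)) : v ∈ S.images := by
  obtain ⟨-, v₁, _, rfl, hd, rfl⟩ := h
  exact ⟨f, hf, by simpa [LevelDer, hc, place_apply] using hd⟩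

theorem ModeInv.edge {m m' : Mode N} {u : List Y} {j : ℕ} {o : Op}
    (he : S.EdgeAt l r (some (m, r), u, j, o, some (m', r))) (acts : S.Acts o c c')
    (h : S.ModeInv m r l c v) : S.ModeInv m' r l c' (v + u) := by
  cases he with
  | guess hi => simpa [ModeInv] using IdleInv.guess h ((acts_guessOp (i := ⟨_, hi⟩)).1 acts)
  | silent hm hν =>
    simp only [silentModes, List.mem_cons, List.mem_map] at hm
    rcases hm with rfl | ⟨e, -, rfl⟩
    · simpa [ModeInv] using IdleInv.silent h hν acts
    · simpa [ModeInv] using DoneInv.silent h hν acts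
  | nil hA =>
    obtain rfl := acts_nil.1 acts
    simpa [ModeInv] using IdleInv.nil h hA
  | leaf mem => exact IdleInv.leaf h mem acts
  | beginTake =>
    obtain rfl := acts_nil.1 acts
    simpa [ModeInv] using DoneInv.beginTake h
  | beginPut =>
    obtain rfl := acts_nil.1 acts
    simpa [ModeInv] using TakeInv.beginPut h
  | take hi => simpa [ModeInv] using TakeInv.take h ((acts_takeOp (i := ⟨_, hi⟩)).1 acts)
  | put hi => simpa [ModeInv] using PutInv.put h ((acts_putOp (i := ⟨_, hi⟩)).1 acts)

theorem Inv.edge {x y : Control N} {u : List Y} {j : ℕ} {o : Op} (hr : S.IsStackAt l r)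
    (he : S.EdgeAt l r (x, u, j, o, y)) (test : ∀ l' < j, c l' = 0) (acts : S.Acts o c c')
    (h : S.Inv x c v) : S.Inv y c' (v + u) := by
  have htail {p : Pending N} {r : List (Pending N)} (hr : S.IsStackAt l (p :: r)) :
      l + 1 + r.length = S.top := by
    rw [← hr.1, List.length_cons]
    omega
  have he' := he
  cases he with
  | final hf =>
    rw [inv_some_iff (l := S.top) rfl] at h
    rintro rfl
    have hc := (acts_transferOp.1 acts).symm
    simp only [placeAll, List.map_nil, List.sum_nil, add_zero, List.map_cons, List.sum_cons,
      zero_add] at hc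
    simpa using DoneInv.mem_images h hf hc
  | call =>
    obtain rfl := acts_nil.1 acts
    rw [inv_some_iff (htail hr)] at h
    rw [inv_some_iff hr.1]
    simpa [ModeInv] using DoneInv.call h
  | finish =>
    obtain rfl := acts_nil.1 acts
    rw [inv_some_iff hr.1] at h
    rw [inv_some_iff (htail hr)]
    simpa [ModeInv] using PutInv.finish (hr.2 _ List.mem_cons_self) h test
  | _ =>
    rw [inv_some_iff hr.1] at h ⊢
    exact ModeInv.edge he' acts h

theorem MRun.inv {x y : Control N} {w : Multiset Y} (h : S.MRun x c w y c') (hx : S.Inv x c v) :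
    S.Inv y c' (v + w) := by
  induction h generalizing v with
  | refl => simpa using hx
  | head mem test acts _ ih =>
    obtain ⟨l, r, hr, he⟩ := mem_edges.1 mem
    rw [← add_assoc]
    exact ih (hx.edge hr he test acts)

theorem MRun.mem_images (h : S.MRun (some (.idle, [])) 0 v none 0) : v ∈ S.images := by
  have hidle : S.IdleInv [] S.top 0 0 := ⟨fun _ _ => rfl, .refl, rfl⟩
  simpa using h.inv ((inv_some_iff rfl).2 hidle) rfl

end NetGrammar

/-! ### Completeness of the structured machine -/

namespace NetGrammar

variable {N Y : Type*} {S : NetGrammar N Y} {l : ℕ} {r : List (Pending N)} {c c' : S.Counters}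
  {v v' : Multiset Y}

theorem IsStackAt.cons {p : Pending N} (hp : p.rule ∈ S.bins) (hr : S.IsStackAt (l + 1) r) :
    S.IsStackAt l (p :: r) :=
  ⟨by rw [← hr.1, List.length_cons]; omega, List.forall_mem_cons.2 ⟨hp, hr.2⟩⟩

theorem EdgeAt.mrun {x y : Control N} {u : List Y} {j : ℕ} {o : Op}
    (he : S.EdgeAt l r (x, u, j, o, y)) (hr : S.IsStackAt l r) (test : ∀ l' < j, c l' = 0)
    (acts : S.Acts o c c') : S.MRun x c u y c' := by
  simpa using MRun.head (mem_edges.2 ⟨l, r, hr, he⟩) test acts (.refl y c')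

theorem EdgeAt.mrun_nil {x y : Control N} {j : ℕ} (he : S.EdgeAt l r (x, [], j, [], y))
    (hr : S.IsStackAt l r) (test : ∀ l' < j, c l' = 0) : S.MRun x c 0 y c :=
  he.mrun hr test (acts_nil.2 rfl)

theorem EdgeAt.mrun_trans {x y z : Control N} {o : Op} {c'' : S.Counters}
    (he : S.EdgeAt l r (x, [], 0, o, y)) (hr : S.IsStackAt l r) (acts : S.Acts o c c')
    (h : S.MRun y c' v z c'') : S.MRun x c v z c'' := by
  simpa using (he.mrun hr (by simp) acts).trans h

theorem MRun.transfer {q : Control N} (f g : (Fin S.dim → ℕ) →+ S.Counters)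
    (h : ∀ i c, S.MRun q (c + f (Pi.single i 1)) 0 q (c + g (Pi.single i 1)))
    (x : Fin S.dim → ℕ) (c : S.Counters) : S.MRun q (c + f x) 0 q (c + g x) := by
  have hadd (x y) (hx : ∀ c, S.MRun q (c + f x) 0 q (c + g x))
      (hy : ∀ c, S.MRun q (c + f y) 0 q (c + g y)) (c) :
      S.MRun q (c + f (x + y)) 0 q (c + g (x + y)) := by
    have h₁ := hx (c + f y)
    have h₂ := hy (c + g x)
    rw [add_right_comm] at h₁ h₂
    simpa only [map_add, add_assoc, add_zero] using h₁.trans h₂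
  refine Pi.single_induction (fun x => ∀ c, S.MRun q (c + f x) 0 q (c + g x)) x
    (fun c => by simpa only [map_zero] using .refl q (c + 0)) hadd (fun i m => ?_) c
  induction m with
  | zero => simpa only [Pi.single_zero, map_zero] using fun c => .refl q (c + 0)
  | succ m ih =>
    rw [Pi.single_add]
    exact hadd _ _ ih (h i)

theorem mrun_guess (hr : S.IsStackAt l r) (x : Fin S.dim → ℕ) (c : S.Counters) :
    S.MRun (some (.idle, r)) c 0 (some (.idle, r)) (c + (place l false x + place l true x)) := by
  have h := MRun.transfer 0 (place l false + place l true) (fun i c =>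
    (EdgeAt.guess i.2).mrun hr (by simp) (acts_guessOp.2 (by simp))) x c
  rwa [AddMonoidHom.zero_apply, add_zero] at h

theorem mrun_take {p : Pending N} (hr : S.IsStackAt l (p :: r)) (x : Fin S.dim → ℕ)
    (c : S.Counters) : S.MRun (some (.take, p :: r))
      (c + (place l (!p.side) x + place (l + 1) p.side x)) 0 (some (.take, p :: r)) c := by
  have h := MRun.transfer (place l (!p.side) + place (l + 1) p.side) 0 (fun i c =>
    (EdgeAt.take i.2).mrun hr (by simp) (acts_takeOp.2 (by simp))) x c
  rwa [AddMonoidHom.zero_apply, add_zero] at h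

theorem mrun_put {p : Pending N} (hr : S.IsStackAt l (p :: r)) (x : Fin S.dim → ℕ)
    (c : S.Counters) : S.MRun (some (.put, p :: r)) (c + place l p.side x) 0
      (some (.put, p :: r)) (c + place (l + 1) p.side x) :=
  MRun.transfer (place l p.side) (place (l + 1) p.side) (fun i c =>
    (EdgeAt.put i.2).mrun hr (by simp) (acts_putOp.2 (add_right_comm _ _ _))) x c

theorem Fire.acts {ν : List ℤ} {a b : Fin S.dim → ℕ} (h : S.Fire ν a b) (c : S.Counters) :
    S.Acts (fireOp l ν) (c + place l true a) (c + place l true b) := by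
  refine acts_fireOp.2 ⟨fun l' s hs => by simp [place_apply, hs], ?_⟩
  simpa [place_apply] using h.add_left (c l true)

theorem Silent.mrun {a b : Fin S.dim → ℕ} {m : Mode N} (h : S.Silent a b)
    (hr : S.IsStackAt l r) (hm : m ∈ S.silentModes) (c : S.Counters) :
    S.MRun (some (m, r)) (c + place l true a) 0 (some (m, r)) (c + place l true b) := by
  induction h using Relation.ReflTransGen.head_induction_on with
  | refl => exact .refl _ _
  | head h _ ih =>
    obtain ⟨ν, hν, hf⟩ := h
    exact (EdgeAt.silent hm hν).mrun_trans hr (hf.acts c) ih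

theorem MRun.call {p : Pending N} {c₁ : S.Counters} {y z : Fin S.dim → ℕ}
    (hp : p.rule ∈ S.bins) (hr : S.IsStackAt (l + 1) r) (h₀ : ∀ l' ≤ l, c₁ l' = 0)
    (hs : S.MRun (some (.idle, r)) c v (some (.done p.spine, r)) (c₁ + place (l + 1) p.side z))
    (hc : S.MRun (some (.idle, p :: r)) (c₁ + place (l + 1) p.side z) v'
      (some (.done p.callee, p :: r))
      (c₁ + place (l + 1) p.side z + (place l (!p.side) z + place l p.side y))) :
    S.MRun (some (.idle, r)) c (v + v') (some (.done p.lhs, r))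
      (c₁ + place (l + 1) p.side y) := by
  have hr' := hr.cons hp
  have hattach : S.MRun (some (.take, p :: r))
      (c₁ + place (l + 1) p.side z + (place l (!p.side) z + place l p.side y)) 0
      (some (.put, p :: r)) (c₁ + place (l + 1) p.side y) := by
    have htake := mrun_take hr' z (c₁ + place l p.side y)
    have hput := mrun_put hr' y c₁
    rw [show c₁ + place (l + 1) p.side z + (place l (!p.side) z + place l p.side y) =
      c₁ + place l p.side y + (place l (!p.side) z + place (l + 1) p.side z) by abel]
    simpa using htake.trans (EdgeAt.beginPut.mrun_trans hr' (acts_nil.2 rfl) hput)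
  have htest : ∀ l' < l + 1, (c₁ + place (l + 1) p.side y) l' = 0 := fun l' hl => by
    simp [h₀ l' (by omega), place_of_ne hl.ne]
  have hfinish := hattach.trans (EdgeAt.finish.mrun_nil hr' htest)
  have hcallee := hc.trans (EdgeAt.beginTake.mrun_trans hr' (acts_nil.2 rfl) hfinish)
  simpa using hs.trans (EdgeAt.call.mrun_trans hr' (acts_nil.2 rfl) hcallee)

theorem Der.mrun {A : N} {a b : Fin S.dim → ℕ} (h : S.Der l A a b v) (hr : S.IsStackAt l r)
    (h₀ : ∀ l' ≤ l, c l' = 0) : S.MRun (some (.idle, r)) c v (some (.done A, r))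
      (c + (place l false a + place l true b)) := by
  have hidle : Mode.idle ∈ S.silentModes := List.mem_cons_self
  have hzero {c : S.Counters} {l : ℕ} (h₀ : ∀ l' ≤ l, c l' = 0) (s : Bool)
      (x : Fin S.dim → ℕ) : ∀ l' ≤ l, (c + place (l + 1) s x) l' = 0 := fun l' hl => by
    simp [h₀ l' hl, place_of_ne (show l' ≠ l + 1 by omega)]
  induction h generalizing r c with
  | @nil l A a b mem h =>
    have hrun := (mrun_guess hr a c).trans (by
      simpa only [add_assoc] using h.mrun hr hidle (c + place l false a))
    simpa using hrun.trans ((EdgeAt.nil mem).mrun_nil hr (by simp))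
  | @leaf l A u ν a m m' b mem h₁ fire h₂ =>
    have hdone : Mode.done A ∈ S.silentModes :=
      List.mem_cons_of_mem _ (List.mem_map.2 ⟨_, mem, rfl⟩)
    have hbefore := h₁.mrun hr hidle (c + place l false a)
    have hafter := h₂.mrun hr hdone (c + place l false a)
    have hleaf := (EdgeAt.leaf mem).mrun hr (by simp) (fire.acts (c + place l false a))
    have hguess := mrun_guess hr a c
    rw [← add_assoc] at hguess ⊢
    simpa using hguess.trans (hbefore.trans (hleaf.trans hafter))
  | @right l A B C a m b v v' mem _ _ hB hC =>
    have hc₁ := hzero (l := l) (fun l' hl => h₀ l' (by omega)) false a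
    have hs := hB hr h₀
    rw [← add_assoc] at hs ⊢
    exact MRun.call (p := ⟨true, A, B, C⟩) mem hr hc₁ hs (hC (hr.cons mem) (hzero hc₁ true m))
  | @left l A B C a m b v v' mem _ _ hB hC =>
    have hc₁ := hzero (l := l) (fun l' hl => h₀ l' (by omega)) true b
    have hs := hC hr h₀
    have hc := hB (hr.cons (p := ⟨false, A, C, B⟩) mem) (hzero hc₁ false m)
    rw [add_comm (place _ false _), ← add_assoc] at hs ⊢
    rw [add_comm (place l false a)] at hc
    rw [add_comm v]
    exact MRun.call (p := ⟨false, A, C, B⟩) mem hr hc₁ hs hc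

theorem mem_images_iff_mrun :
    v ∈ S.images ↔ S.MRun (some (.idle, [])) 0 v none 0 := by
  refine ⟨?_, MRun.mem_images⟩
  rintro ⟨f, hf, hd⟩
  have hr : S.IsStackAt S.top [] := ⟨rfl, by simp⟩
  have hacts : S.Acts (transferOp [(S.top, false, S.initMarking), (S.top, true, f)] [])
      (0 + (place S.top false (vectorOfList S.dim S.initMarking) +
        place S.top true (vectorOfList S.dim f))) 0 :=
    acts_transferOp.2 (by simp [placeAll])
  simpa using (hd.mrun hr (c := 0) fun _ _ => rfl).trans
    ((EdgeAt.final hf).mrun_trans hr hacts (.refl none 0))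

end NetGrammar

/-! ### Flattening of the structured machine -/

/-- The number that the operation `o` adds to coordinate `i` of the marking with level `l` and
side `s`. -/
def opEntry (o : NetGrammar.Op) (l : ℕ) (s : Bool) (i : ℕ) : ℤ :=
  (o.map fun e => if e.1 = l ∧ e.2.1 = s then e.2.2.getD i 0 else 0).sum

namespace NetGrammar

variable {N Y : Type*}

/-- The number of counters of the priority machine: two markings for each level. -/
def numCounters (S : NetGrammar N Y) : ℕ := (S.top + 1) * (2 * S.dim)

/-- The arrangement of the counters. Lower levels come first, so that the tests of the structured
machine become priority tests. -/
def counterEquiv (S : NetGrammar N Y) :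
    Fin S.numCounters ≃ Fin (S.top + 1) × Bool × Fin S.dim :=
  finProdFinEquiv.symm.trans
    (.prodCongr (.refl _) (finProdFinEquiv.symm.trans (.prodCongr finTwoEquiv (.refl _))))

/-- The marking of the priority machine with the given counter values. -/
def flatten (S : NetGrammar N Y) (c : S.Counters) : Fin S.numCounters → ℕ := fun n =>
  c (S.counterEquiv n).1 (S.counterEquiv n).2.1 (S.counterEquiv n).2.2

/-- The counter values in a marking of the priority machine. -/
def unflatten (S : NetGrammar N Y) (μ : Fin S.numCounters → ℕ) : S.Counters := fun l s i =>
  if h : l < S.top + 1 then μ (S.counterEquiv.symm (⟨l, h⟩, s, i)) else 0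

/-- The vector that belongs to an operation. -/
def opList (S : NetGrammar N Y) (o : Op) : List ℤ :=
  (List.range S.numCounters).map fun n => opEntry o (n / (2 * S.dim))
    (decide (n % (2 * S.dim) / S.dim = 1)) (n % S.dim)

/-- The edge of the priority machine that belongs to an edge of the structured machine, for the
state names `name`. -/
def priorityEdge (S : NetGrammar N Y) {Q : Type*} (name : Control N → Q) (e : Edge N Y) :
    Q × List Y × Fin (S.numCounters + 1) × (Fin S.numCounters → ℤ) × Q :=
  (name e.1, e.2.1, Fin.ofNat _ (e.2.2.1 * (2 * S.dim)), vectorOfList _ (S.opList e.2.2.2.1),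
    name e.2.2.2.2)

/-- The control states that occur. -/
def controls (S : NetGrammar N Y) : Set (Control N) :=
  {x | x = some (.idle, []) ∨ x = none ∨ ∃ e ∈ S.edges, x = e.1 ∨ x = e.2.2.2.2}

variable {S : NetGrammar N Y}

theorem placeAll_apply (d : ℕ) (o : Op) (l : ℕ) (s : Bool) (i : Fin d) :
    placeAll d o l s i = opEntry o l s i := by
  induction o with
  | nil => simp [placeAll, opEntry]
  | cons e o ih =>
    simp only [placeAll, opEntry, List.map_cons, List.sum_cons, Pi.add_apply] at ih ⊢
    rw [ih, place_apply]
    simp only [eq_comm (a := l), eq_comm (a := s), vectorOfList, ite_apply, Pi.zero_apply]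

theorem opEntry_of_ne {o : Op} {l : ℕ} (h : ∀ e ∈ o, e.1 ≠ l) (s : Bool) (i : ℕ) :
    opEntry o l s i = 0 :=
  List.sum_eq_zero fun x hx => by
    obtain ⟨e, he, rfl⟩ := List.mem_map.1 hx
    simp [h e he]

theorem vectorOfList_opList (o : Op) (n : Fin S.numCounters) :
    vectorOfList S.numCounters (S.opList o) n =
      placeAll S.dim o (S.counterEquiv n).1 (S.counterEquiv n).2.1 (S.counterEquiv n).2.2 := by
  rw [placeAll_apply]
  have hlevel : ((S.counterEquiv n).1 : ℕ) = n / (2 * S.dim) := rfl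
  have hside : (S.counterEquiv n).2.1 = decide (n % (2 * S.dim) / S.dim = 1) :=
    (by decide : ∀ x : Fin 2, finTwoEquiv x = decide ((x : ℕ) = 1)) _
  have hcoord : ((S.counterEquiv n).2.2 : ℕ) = n % S.dim := Nat.mod_mul_left_mod _ _ _
  rw [hlevel, hside, hcoord]
  simp [vectorOfList, opList, n.2]

theorem counterEquiv_level_lt_iff (n : Fin S.numCounters) (j : ℕ) :
    ((S.counterEquiv n).1 : ℕ) < j ↔ n < j * (2 * S.dim) := by
  have hdim : 0 < S.dim := Fin.pos (S.counterEquiv n).2.2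
  exact Nat.div_lt_iff_lt_mul (by omega)

theorem unflatten_zero : S.unflatten 0 = 0 := by
  funext l s i
  simp [unflatten]

theorem EdgeAt.test_le {l : ℕ} {r : List (Pending N)} {e : Edge N Y} (h : S.EdgeAt l r e)
    (hr : S.IsStackAt l r) : e.2.2.1 ≤ S.top + 1 := by
  have := hr.1
  cases h <;> (simp only; omega)

theorem EdgeAt.level_le {l : ℕ} {r : List (Pending N)} {e : Edge N Y} (h : S.EdgeAt l r e)
    (hr : S.IsStackAt l r) : ∀ t ∈ e.2.2.2.1, t.1 ≤ S.top := by
  have := hr.1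
  cases h <;> simp_all [guessOp, takeOp, putOp, fireOp, transferOp] <;> omega

/-- `A` is the priority machine of `S`, with state names given by `name`. -/
structure IsMachine (S : NetGrammar N Y) (A : PriorityMachine Y S.numCounters)
    (name : Control N → A.State) : Prop where
  start : A.start = name (some (.idle, []))
  final : ∀ q, q ∈ A.final ↔ q = name none
  injOn : Set.InjOn name S.controls
  edges : ∀ x, x ∈ A.edges ↔ ∃ e ∈ S.edges, S.priorityEdge name e = x

section IsMachine

variable {A : PriorityMachine Y S.numCounters} {name : Control N → A.State}

theorem val_ofNat_test {j : ℕ} (hj : j ≤ S.top + 1) :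
    (Fin.ofNat (S.numCounters + 1) (j * (2 * S.dim)) : ℕ) = j * (2 * S.dim) :=
  Nat.mod_eq_of_lt (Nat.lt_succ_of_le (Nat.mul_le_mul_right _ hj))

theorem unflatten_test {μ : Fin S.numCounters → ℕ} {j : ℕ}
    (test : ∀ n : Fin S.numCounters, (n : ℕ) < j * (2 * S.dim) → μ n = 0) :
    ∀ l < j, S.unflatten μ l = 0 := by
  intro l hl
  funext s i
  rw [unflatten]
  split_ifs with h
  · exact test _ ((counterEquiv_level_lt_iff _ j).1 (by simpa using hl))
  · rfl

theorem unflatten_acts {o : Op} {μ μ' : Fin S.numCounters → ℕ} (ho : ∀ t ∈ o, t.1 ≤ S.top)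
    (add : ∀ n, (μ' n : ℤ) = μ n + vectorOfList S.numCounters (S.opList o) n) :
    S.Acts o (S.unflatten μ) (S.unflatten μ') := by
  intro l s i
  simp only [unflatten]
  split_ifs with h
  · simp [add, vectorOfList_opList]
  · rw [placeAll_apply, opEntry_of_ne (fun t ht => by have := ho t ht; omega)]
    rfl

theorem IsMachine.mrun_of_run (hA : S.IsMachine A name) {x y : A.State}
    {μ μ' : Fin S.numCounters → ℕ} {w : List Y} (h : A.Run x μ w y μ') {p : Control N}
    (hp : p ∈ S.controls) (hx : x = name p) :
    ∃ q ∈ S.controls, y = name q ∧ S.MRun p (S.unflatten μ) w q (S.unflatten μ') := by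
  induction h generalizing p with
  | nil => exact ⟨p, hp, hx, .refl _ _⟩
  | cons mem test add rest ih =>
    obtain ⟨⟨p', u, j, o, q'⟩, he, heq⟩ := (hA.edges _).1 mem
    simp only [priorityEdge, Prod.mk.injEq] at heq
    obtain ⟨rfl, rfl, rfl, rfl, rfl⟩ := heq
    obtain rfl := hA.injOn hp (.inr (.inr ⟨_, he, .inl rfl⟩)) hx.symm
    obtain ⟨q, hq, rfl, h⟩ := ih (.inr (.inr ⟨_, he, .inr rfl⟩)) rfl
    obtain ⟨l, r, hr, hlr⟩ := mem_edges.1 he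
    rw [val_ofNat_test (hlr.test_le hr)] at test
    rw [← Multiset.coe_add]
    exact ⟨q, hq, rfl, .head he (unflatten_test test) (unflatten_acts (hlr.level_le hr) add) h⟩

theorem IsMachine.run_of_mrun (hA : S.IsMachine A name) {p q : Control N}
    {c c' : S.Counters} {v : Multiset Y} (h : S.MRun p c v q c') : ∃ w : List Y,
      (w : Multiset Y) = v ∧ A.Run (name p) (S.flatten c) w (name q) (S.flatten c') := by
  induction h with
  | refl p c => exact ⟨[], rfl, .nil _ _⟩
  | @head p p₁ q c c₁ c' u v j o mem test acts rest ih =>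
    obtain ⟨w, rfl, h⟩ := ih
    obtain ⟨l, r, hr, hlr⟩ := mem_edges.1 mem
    refine ⟨u ++ w, (Multiset.coe_add u w).symm,
      .cons ((hA.edges _).2 ⟨_, mem, rfl⟩) (fun n hn => ?_) (fun n => ?_) h⟩
    · rw [val_ofNat_test (hlr.test_le hr), ← counterEquiv_level_lt_iff] at hn
      rw [flatten, test _ hn]
      rfl
    · rw [vectorOfList_opList]
      exact acts _ _ _

theorem IsMachine.mem_images_iff (hA : S.IsMachine A name) {v : Multiset Y} :
    v ∈ S.images ↔ ∃ w ∈ A.language, (w : Multiset Y) = v := by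
  rw [mem_images_iff_mrun]
  constructor
  · intro h
    obtain ⟨w, hw, h⟩ := hA.run_of_mrun h
    exact ⟨w, ⟨name none, (hA.final _).2 rfl, by rwa [hA.start]⟩, hw⟩
  · rintro ⟨w, ⟨f, hf, h⟩, rfl⟩
    obtain ⟨q, hq, hf', h⟩ := hA.mrun_of_run h (.inl rfl) hA.start
    obtain rfl := hA.injOn hq (.inr (.inl rfl)) (hf'.symm.trans ((hA.final _).1 hf))
    rwa [unflatten_zero] at h

end IsMachine

theorem controls_finite : S.controls.Finite := by
  have hsub : S.controls ⊆ ↑({some (.idle, []), none} ∪ {x | x ∈ S.edges.map fun e => e.1} ∪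
      {x | x ∈ S.edges.map fun e => e.2.2.2.2} : Set (Control N)) := by
    rintro x (rfl | rfl | ⟨e, he, rfl | rfl⟩)
    · simp
    · simp
    · exact .inl (.inr (List.mem_map.2 ⟨e, he, rfl⟩))
    · exact .inr (List.mem_map.2 ⟨e, he, rfl⟩)
  exact (((Set.toFinite _).union (List.finite_toSet _)).union (List.finite_toSet _)).subset hsub

open Classical in
theorem exists_isMachine {N : Type} (S : NetGrammar N Y) :
    ∃ (A : PriorityMachine Y S.numCounters) (name : Control N → A.State),
      S.IsMachine A name := by
  let start : S.controls := ⟨some (.idle, []), .inl rfl⟩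
  let name : Control N → S.controls := fun x => if h : x ∈ S.controls then ⟨x, h⟩ else start
  refine ⟨{
    State := S.controls
    finite_state := controls_finite.to_subtype
    edges := (S.edges.map (S.priorityEdge name)).toFinset
    start := name (some (.idle, []))
    final := {name none} }, name, rfl, fun q => Iff.rfl, fun x hx y hy h => ?_, fun x => ?_⟩
  · simpa [name, hx, hy] using h
  · exact List.mem_toFinset.trans List.mem_map

end NetGrammar

/-! ### Representations by lists -/

theorem parikhImage_eq_of_multisets {X : Type*} [DecidableEq X] {L L' : Language X}
    (h : ∀ v : Multiset X, (∃ w ∈ L, (w : Multiset X) = v) ↔ ∃ w ∈ L', (w : Multiset X) = v) :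
    parikhImage L = parikhImage L' := by
  have hcount (L : Language X) : parikhImage L =
      (fun v : Multiset X => fun x => v.count x) '' {v | ∃ w ∈ L, (w : Multiset X) = v} := by
    ext f
    simp [parikhImage, parikh, funext_iff]
  simp only [hcount, h]

theorem exists_list_forall_mem_iff {α β : Type*} (f : α → β) (hf : Function.Injective f)
    (s : Finset β) : ∃ l : List α, ∀ a, a ∈ l ↔ f a ∈ s :=
  ⟨(s.finite_toSet.preimage hf.injOn).toFinset.toList, fun a => by simp⟩

theorem vectorOfList_ofFn {R : Type*} [Zero R] {d : ℕ} (f : Fin d → R) :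
    vectorOfList d (List.ofFn f) = f :=
  funext fun i => by simp [vectorOfList]

theorem PetriNet.exists_transitionList {X : Type*} {d : ℕ} (P : PetriNet X d) :
    ∃ L : List (Option X × List ℤ), ∀ x ν,
      (x, ν) ∈ P.transitions ↔ ∃ l, (x, l) ∈ L ∧ vectorOfList d l = ν := by
  refine ⟨P.transitions.toList.map fun t => (t.1, List.ofFn t.2), fun x ν => ?_⟩
  simp only [List.mem_map, Finset.mem_toList, Prod.mk.injEq]
  constructor
  · exact fun hν => ⟨_, ⟨_, hν, rfl, rfl⟩, vectorOfList_ofFn ν⟩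
  · rintro ⟨_, ⟨t, ht, rfl, rfl⟩, rfl⟩
    rwa [vectorOfList_ofFn]

namespace NetGrammar

/-- The leaf data for terminal productions, transitions and images of letters. -/
def joinLeaves {N X Y : Type*} [DecidableEq X] (h : X → List Y) (terms : List (N × X))
    (transitions : List (Option X × List ℤ)) : List (N × List Y × List ℤ) :=
  terms.flatMap fun b => transitions.filterMap fun t =>
    if t.1 = some b.2 then some (b.1, h b.2, t.2) else none

/-- The effects of the transitions without a label. -/
def silentEffects {X : Type*} (transitions : List (Option X × List ℤ)) : List (List ℤ) :=
  transitions.filterMap fun t => if t.1 = none then some t.2 else none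

theorem mem_joinLeaves {N X Y : Type*} [DecidableEq X] {h : X → List Y} {terms : List (N × X)}
    {transitions : List (Option X × List ℤ)} {A : N} {u : List Y} {ν : List ℤ} :
    (A, u, ν) ∈ joinLeaves h terms transitions ↔
      ∃ x, (A, x) ∈ terms ∧ (some x, ν) ∈ transitions ∧ h x = u := by
  simp only [joinLeaves, List.mem_flatMap, List.mem_filterMap, Option.ite_none_right_eq_some,
    Option.some.injEq, Prod.mk.injEq]
  constructor
  · rintro ⟨⟨A', x⟩, hx, ⟨_, ν'⟩, hν, rfl, rfl, rfl, rfl⟩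
    exact ⟨x, hx, hν, rfl⟩
  · rintro ⟨x, hx, hν, rfl⟩
    exact ⟨_, hx, _, hν, rfl, rfl, rfl, rfl⟩

theorem mem_silentEffects {X : Type*} {transitions : List (Option X × List ℤ)} {ν : List ℤ} :
    ν ∈ silentEffects transitions ↔ (none, ν) ∈ transitions := by
  simp [silentEffects]

open Classical in
theorem exists_represents {X : Type} {Y : Type*} (G : ContextFreeGrammar.{0} X) (top : ℕ) {d : ℕ}
    (P : PetriNet X d) (h : X → List Y) :
    ∃ (S : NetGrammar G.NT Y) (P' : PetriNet X S.dim), S.top = top ∧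
      P'.language = P.language ∧ S.Represents G P' h := by
  obtain ⟨nils, hnils⟩ := exists_list_forall_mem_iff
    (fun A => (ContextFreeRule.mk A [] : ContextFreeRule X G.NT))
    (fun _ _ h => by simpa using h) G.rules
  obtain ⟨terms, hterms⟩ := exists_list_forall_mem_iff
    (fun b : G.NT × X => (ContextFreeRule.mk b.1 [Symbol.terminal b.2] : ContextFreeRule X G.NT))
    (fun _ _ h => by simpa [Prod.ext_iff] using h) G.rules
  obtain ⟨bins, hbins⟩ := exists_list_forall_mem_iff
    (fun b : G.NT × G.NT × G.NT => (ContextFreeRule.mk b.1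
      [Symbol.nonterminal b.2.1, Symbol.nonterminal b.2.2] : ContextFreeRule X G.NT))
    (fun _ _ h => by simpa [Prod.ext_iff] using h) G.rules
  obtain ⟨transitions, htransitions⟩ := P.exists_transitionList
  exact ⟨{
    dim := d
    top := top
    start := G.initial
    nils := nils
    leaves := joinLeaves h terms transitions
    bins := bins
    silent := silentEffects transitions
    initMarking := List.ofFn P.initial
    final := P.final.toList.map List.ofFn }, P, rfl, rfl, {
      start := rfl
      initMarking := vectorOfList_ofFn _
      final := fun f => by simp [vectorOfList_ofFn]
      nils := hnils
      bins := fun A B C => hbins (A, B, C)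
      silent := fun ν => by simp [htransitions, mem_silentEffects]
      of_leaves := fun A u l hl => by
        obtain ⟨x, hx, ht, rfl⟩ := mem_joinLeaves.1 hl
        exact ⟨x, (hterms (A, x)).1 hx, (htransitions _ _).2 ⟨l, ht, rfl⟩, rfl⟩
      leaves := fun A x ν hA hν => by
        obtain ⟨l, hl, rfl⟩ := (htransitions _ _).1 hν
        exact ⟨l, rfl, mem_joinLeaves.2 ⟨x, (hterms (A, x)).2 hA, hl, rfl⟩⟩ }⟩

end NetGrammar

/-! ### Codes of machines and languages -/

theorem MachineCode.mem_edges_iff (c : MachineCode) {x : Fin (c.maxState + 1) × List ℕ ×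
    Fin (c.counters + 1) × (Fin c.counters → ℤ) × Fin (c.maxState + 1)} :
    x ∈ c.toMachine.edges ↔ ∃ e ∈ c.edges, (Fin.ofNat (c.maxState + 1) e.1, e.2.1,
      Fin.ofNat (c.counters + 1) e.2.2.1, vectorOfList c.counters e.2.2.2.1,
      Fin.ofNat (c.maxState + 1) e.2.2.2.2) = x :=
  List.mem_toFinset.trans List.mem_map

namespace NetGrammar

/-- Modes as elements of a sum of primitive recursive types. -/
def Mode.equiv {N : Type*} : Mode N ≃ Option N ⊕ Bool where
  toFun
    | .idle => .inl none
    | .done A => .inl (some A)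
    | .take => .inr false
    | .put => .inr true
  invFun
    | .inl none => .idle
    | .inl (some A) => .done A
    | .inr false => .take
    | .inr true => .put
  left_inv := by rintro (_ | _ | _ | _) <;> rfl
  right_inv := by rintro ((_ | _) | (_ | _)) <;> rfl

instance {N : Type*} [Primcodable N] : Primcodable (Mode N) := Primcodable.ofEquiv _ Mode.equiv

/-- Pending productions as tuples. -/
def Pending.equiv {N : Type*} : Pending N ≃ Bool × N × N × N where
  toFun p := (p.side, p.lhs, p.spine, p.callee)
  invFun p := ⟨p.1, p.2.1, p.2.2.1, p.2.2.2⟩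

instance {N : Type*} [Primcodable N] : Primcodable (Pending N) :=
  Primcodable.ofEquiv _ Pending.equiv

variable {N : Type*} [Primcodable N]

/-- A bound for the codes of the control states. -/
def controlBound {Y : Type*} (S : NetGrammar N Y) : ℕ :=
  (S.edges.map fun e => Encodable.encode e.1 + Encodable.encode e.2.2.2.2).sum +
    Encodable.encode (some (.idle, []) : Control N)

/-- The code of an edge of the priority machine. -/
def edgeCode {Y : Type*} (S : NetGrammar N Y) (e : Edge N Y) : ℕ × List Y × ℕ × List ℤ × ℕ :=
  (Encodable.encode e.1, e.2.1, e.2.2.1 * (2 * S.dim), S.opList e.2.2.2.1,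
    Encodable.encode e.2.2.2.2)

/-- The code of the priority machine, with the codes of the control states as state names. -/
def machineCode (S : NetGrammar N ℕ) : MachineCode where
  counters := S.numCounters
  maxState := S.controlBound
  edges := S.edges.map S.edgeCode
  start := Encodable.encode (some (.idle, []) : Control N)
  final := [Encodable.encode (none : Control N)]

theorem encode_le_controlBound {Y : Type*} {S : NetGrammar N Y} {x : Control N}
    (hx : x ∈ S.controls) : Encodable.encode x ≤ S.controlBound := by
  rcases hx with rfl | rfl | ⟨e, he, h⟩
  · exact Nat.le_add_left _ _
  · exact Nat.zero_le _
  · have hsum := List.single_le_sum (by simp) _ (List.mem_map_of_mem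
      (f := fun e : Edge N Y => Encodable.encode e.1 + Encodable.encode e.2.2.2.2) he)
    refine le_trans ?_ (hsum.trans (Nat.le_add_right _ _))
    rcases h with rfl | rfl
    · exact Nat.le_add_right _ _
    · exact Nat.le_add_left _ _

theorem isMachine_machineCode (S : NetGrammar N ℕ) : S.IsMachine S.machineCode.toMachine
    fun x => Fin.ofNat (S.controlBound + 1) (Encodable.encode x) where
  start := rfl
  final q := by
    constructor
    · rintro ⟨n, hn, rfl⟩
      rw [List.mem_singleton.1 hn]
      rfl
    · exact fun h => ⟨_, List.mem_singleton.2 rfl, h⟩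
  injOn x hx y hy h := by
    have hval := congrArg Fin.val h
    simp only [Fin.val_ofNat] at hval
    rw [Nat.mod_eq_of_lt (Nat.lt_succ_of_le (encode_le_controlBound hx)),
      Nat.mod_eq_of_lt (Nat.lt_succ_of_le (encode_le_controlBound hy))] at hval
    exact Encodable.encode_injective hval
  edges x := by
    refine S.machineCode.mem_edges_iff.trans ⟨?_, ?_⟩
    · rintro ⟨_, h, rfl⟩
      obtain ⟨e, he, rfl⟩ := List.mem_map.1 h
      exact ⟨e, he, rfl⟩
    · rintro ⟨e, he, rfl⟩
      exact ⟨_, List.mem_map_of_mem he, rfl⟩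

end NetGrammar

theorem symbolOfCode_injective : Function.Injective symbolOfCode := by
  rintro (a | a) (b | b) h <;> cases h <;> rfl

theorem GrammarCode.mem_rules_iff {c : GrammarCode} {A : ℕ} (w : List (ℕ ⊕ ℕ)) :
    ContextFreeRule.mk A (w.map symbolOfCode) ∈ c.toGrammar.rules ↔ (A, w) ∈ c.rules := by
  refine (List.mem_toFinset.trans List.mem_map).trans ⟨?_, fun h => ⟨_, h, rfl⟩⟩
  rintro ⟨⟨A', w'⟩, hr, h⟩
  simp only [ContextFreeRule.mk.injEq] at h
  obtain ⟨rfl, h⟩ := h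
  rwa [← List.map_injective_iff.2 symbolOfCode_injective h]

theorem GrammarCode.rule_cases {c : GrammarCode} (hc : IsChomskyNF c.toGrammar) {A : ℕ}
    {w : List (ℕ ⊕ ℕ)} (h : (A, w) ∈ c.rules) :
    (∃ B C, w = [.inr B, .inr C]) ∨ (∃ a, w = [.inl a]) ∨ w = [] := by
  have hinj := List.map_injective_iff.2 symbolOfCode_injective
  exact (hc _ ((mem_rules_iff w).2 h)).imp
    (fun ⟨B, C, h⟩ => ⟨B, C, hinj h⟩) (.imp (fun ⟨a, h⟩ => ⟨a, hinj h⟩) (@hinj w []))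

theorem PetriNetCode.mem_transitions_iff {c : PetriNetCode} {x : Option ℕ}
    {ν : Fin c.dim → ℤ} :
    (x, ν) ∈ c.toPetriNet.transitions ↔
      ∃ l, (x, l) ∈ c.transitions ∧ vectorOfList c.dim l = ν := by
  simp [PetriNetCode.toPetriNet]

namespace LanguageCode

open GrammarCode PetriNetCode

/-- The nonterminal `A` of a production `A → ε`. -/
def nilRule (r : ℕ × List (ℕ ⊕ ℕ)) : Option ℕ := if r.2.length = 0 then some r.1 else none

/-- The pair `(A, a)` for a production `A → a`. -/
def leafRule (r : ℕ × List (ℕ ⊕ ℕ)) : Option (ℕ × ℕ) :=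
  (r.2[0]?.bind Sum.getLeft?).map fun a => (r.1, a)

/-- The triple `(A, B, C)` for a production `A → BC`. -/
def binRule (r : ℕ × List (ℕ ⊕ ℕ)) : Option (ℕ × ℕ × ℕ) :=
  (r.2[0]?.bind Sum.getRight?).bind fun B => (r.2[1]?.bind Sum.getRight?).map fun C => (r.1, B, C)

/-- The grammar and the net of a language code. -/
def netGrammar (c : LanguageCode) : NetGrammar ℕ ℕ where
  dim := c.net.dim
  top := c.index - 1
  start := c.grammar.start
  nils := c.grammar.rules.filterMap nilRule
  leaves := NetGrammar.joinLeaves (fun x => c.images.getD x [])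
    (c.grammar.rules.filterMap leafRule) c.net.transitions
  bins := c.grammar.rules.filterMap binRule
  silent := NetGrammar.silentEffects c.net.transitions
  initMarking := c.net.initial
  final := c.net.final

theorem mem_filterMap_nilRule {c : GrammarCode} {A : ℕ} :
    A ∈ c.rules.filterMap nilRule ↔ (A, []) ∈ c.rules := by
  simp [nilRule]

theorem mem_filterMap_leafRule {c : GrammarCode} (hc : IsChomskyNF c.toGrammar) {A a : ℕ} :
    (A, a) ∈ c.rules.filterMap leafRule ↔ (A, [.inl a]) ∈ c.rules := by
  rw [List.mem_filterMap]
  refine ⟨?_, fun h => ⟨_, h, rfl⟩⟩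
  rintro ⟨⟨A', w⟩, hr, h⟩
  rcases rule_cases hc hr with ⟨B, C, rfl⟩ | ⟨a', rfl⟩ | rfl
  all_goals cases h
  exact hr

theorem mem_filterMap_binRule {c : GrammarCode} (hc : IsChomskyNF c.toGrammar) {A B C : ℕ} :
    (A, B, C) ∈ c.rules.filterMap binRule ↔ (A, [.inr B, .inr C]) ∈ c.rules := by
  rw [List.mem_filterMap]
  refine ⟨?_, fun h => ⟨_, h, rfl⟩⟩
  rintro ⟨⟨A', w⟩, hr, h⟩
  rcases rule_cases hc hr with ⟨B', C', rfl⟩ | ⟨a, rfl⟩ | rfl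
  all_goals cases h
  exact hr

theorem netGrammar_represents {c : LanguageCode} (hc : IsChomskyNF c.grammar.toGrammar) :
    c.netGrammar.Represents c.grammar.toGrammar c.net.toPetriNet
      (fun x => c.images.getD x []) where
  start := rfl
  initMarking := rfl
  final _ := List.mem_toFinset.trans List.mem_map
  nils A := mem_filterMap_nilRule.trans (mem_rules_iff []).symm
  bins A B C := (mem_filterMap_binRule hc).trans (mem_rules_iff [.inr B, .inr C]).symm
  silent ν := mem_transitions_iff.trans
    (exists_congr fun _ => and_congr_left fun _ => NetGrammar.mem_silentEffects.symm)
  of_leaves A u l h := by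
    obtain ⟨a, ha, ht, rfl⟩ := (NetGrammar.mem_joinLeaves (h := fun x => c.images.getD x [])).1 h
    exact ⟨a, (mem_rules_iff [.inl a]).2 ((mem_filterMap_leafRule hc).1 ha),
      mem_transitions_iff.2 ⟨_, ht, rfl⟩, rfl⟩
  leaves A x ν hA hν := by
    obtain ⟨l, hl, rfl⟩ := mem_transitions_iff.1 hν
    have hx := (mem_filterMap_leafRule hc).2 ((mem_rules_iff [.inl x]).1 hA)
    exact ⟨l, rfl, (NetGrammar.mem_joinLeaves (h := fun x => c.images.getD x [])).2
      ⟨x, hx, hl, rfl⟩⟩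

theorem parikhImage_machineCode {c : LanguageCode} (hc : c.Valid) :
    parikhImage c.netGrammar.machineCode.toMachine.language = parikhImage c.language := by
  refine parikhImage_eq_of_multisets fun v => ?_
  have htop : c.netGrammar.top + 1 = c.index := Nat.sub_add_cancel hc.2
  have himages := (netGrammar_represents hc.1).mem_images_iff hc.1 (v := v)
  rw [htop] at himages
  exact c.netGrammar.isMachine_machineCode.mem_images_iff.symm.trans himages

end LanguageCode

/-! ### Computability of the construction -/

section PrimrecInt

open Primrec

theorem primrec_intEquivNatSumNat : Primrec Equiv.intEquivNatSumNat :=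
  Primrec.encode_iff.1 (Primrec.encode.of_eq fun z => by cases z <;> rfl)

theorem primrec_intEquivNatSumNat_symm : Primrec Equiv.intEquivNatSumNat.symm :=
  Primrec.encode_iff.1 (Primrec.encode.of_eq fun z => by cases z <;> rfl)

theorem primrec_int_toNat : Primrec Int.toNat :=
  (sumCasesOn (g := fun _ n => n) (h := fun _ _ => 0) primrec_intEquivNatSumNat snd
    (const 0)).of_eq fun z => by cases z <;> rfl

theorem primrec_int_toNat_neg : Primrec fun z : ℤ => (-z).toNat :=
  (sumCasesOn (g := fun _ _ => 0) (h := fun _ n => n + 1) primrec_intEquivNatSumNat (const 0)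
    (succ.comp snd).to₂).of_eq fun z => by
      rcases z with n | n
      · exact (Int.toNat_of_nonpos (Int.neg_nonpos_of_nonneg (Int.natCast_nonneg n))).symm
      · rfl

theorem primrec₂_natCast_int_sub : Primrec₂ fun m n : ℕ => (m : ℤ) - n := by
  have hinl : Primrec fun x : ℕ × ℕ => Equiv.intEquivNatSumNat.symm (.inl (x.1 - x.2)) :=
    primrec_intEquivNatSumNat_symm.comp (sumInl.comp (nat_sub.comp fst snd))
  have hinr : Primrec fun x : ℕ × ℕ => Equiv.intEquivNatSumNat.symm (.inr (x.2 - x.1 - 1)) :=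
    primrec_intEquivNatSumNat_symm.comp
      (sumInr.comp (nat_sub.comp (nat_sub.comp snd fst) (const 1)))
  refine (Primrec.ite (nat_le.comp snd fst) hinl hinr).of_eq fun x => ?_
  split_ifs with h
  · exact Int.ofNat_sub h
  · change Int.negSucc (x.2 - x.1 - 1) = x.1 - x.2
    omega

theorem primrec_natCast_int : Primrec fun n : ℕ => (n : ℤ) :=
  (primrec₂_natCast_int_sub.comp .id (const 0)).of_eq fun _ => sub_zero _

theorem primrec_neg_natCast_int : Primrec fun n : ℕ => -(n : ℤ) :=
  (primrec₂_natCast_int_sub.comp (const 0) .id).of_eq fun _ => zero_sub _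

theorem primrec₂_int_add : Primrec₂ fun a b : ℤ => a + b := by
  refine (primrec₂_natCast_int_sub.comp
    (nat_add.comp (primrec_int_toNat.comp fst) (primrec_int_toNat.comp snd))
    (nat_add.comp (primrec_int_toNat_neg.comp fst) (primrec_int_toNat_neg.comp snd))).of_eq ?_
  intro x
  push_cast
  omega

theorem primrec_list_sum {M : Type*} [AddMonoid M] [Primcodable M]
    (hadd : Primrec₂ fun a b : M => a + b) : Primrec (List.sum : List M → M) :=
  (list_foldr (h := fun _ x => x.1 + x.2) .id (const 0)
    (hadd.comp (fst.comp snd) (snd.comp snd))).of_eq fun _ => List.sum_eq_foldr.symm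

end PrimrecInt

namespace NetGrammar

open Primrec

section Ops

variable {α : Type*} [Primcodable α]

theorem primrec_unitList : Primrec unitList :=
  (list_append.comp (list_map list_range (Primrec₂.const 0)) (const [1])).of_eq fun i => by
    simp [unitList, List.map_const']

theorem primrec_transferOp {sub add : α → List (ℕ × Bool × List ℕ)} (hsub : Primrec sub)
    (hadd : Primrec add) : Primrec fun a => transferOp (sub a) (add a) := by
  have hmap {f : ℕ → ℤ} (hf : Primrec f) :
      Primrec fun e : ℕ × Bool × List ℕ => (e.1, e.2.1, e.2.2.map f) :=
    pair fst (pair (fst.comp snd) (list_map (snd.comp snd) (hf.comp snd)))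
  exact list_append.comp (list_map hsub ((hmap primrec_neg_natCast_int).comp snd))
    (list_map hadd ((hmap primrec_natCast_int).comp snd))

theorem primrec_fireOp {l : α → ℕ} {ν : α → List ℤ} (hl : Primrec l) (hν : Primrec ν) :
    Primrec fun a => fireOp (l a) (ν a) :=
  list_cons.comp (pair hl (pair (const true) hν)) (const [])

theorem primrec_guessOp {l i : α → ℕ} (hl : Primrec l) (hi : Primrec i) :
    Primrec fun a => guessOp (l a) (i a) :=
  have hi := primrec_unitList.comp hi
  primrec_transferOp (const []) (list_cons.comp (pair hl (pair (const false) hi))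
    (list_cons.comp (pair hl (pair (const true) hi)) (const [])))

theorem primrec_takeOp {l i : α → ℕ} {s : α → Bool} (hl : Primrec l) (hs : Primrec s)
    (hi : Primrec i) : Primrec fun a => takeOp (l a) (s a) (i a) :=
  have hi := primrec_unitList.comp hi
  primrec_transferOp (list_cons.comp (pair hl (pair (Primrec.not.comp hs) hi))
    (list_cons.comp (pair (succ.comp hl) (pair hs hi)) (const []))) (const [])

theorem primrec_putOp {l i : α → ℕ} {s : α → Bool} (hl : Primrec l) (hs : Primrec s)
    (hi : Primrec i) : Primrec fun a => putOp (l a) (s a) (i a) :=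
  have hi := primrec_unitList.comp hi
  primrec_transferOp (list_cons.comp (pair hl (pair hs hi)) (const []))
    (list_cons.comp (pair (succ.comp hl) (pair hs hi)) (const []))

theorem primrec_opEntry {o : α → Op} {l i : α → ℕ} {s : α → Bool} (ho : Primrec o)
    (hl : Primrec l) (hs : Primrec s) (hi : Primrec i) :
    Primrec fun a => opEntry (o a) (l a) (s a) (i a) := by
  refine (primrec_list_sum primrec₂_int_add).comp (list_map ho (Primrec.ite ?_ ?_ (const 0)))
  · exact (Primrec.eq.comp (fst.comp snd) (hl.comp fst)).and
      (Primrec.eq.comp (fst.comp (snd.comp snd)) (hs.comp fst))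
  · exact (list_getD 0).comp (snd.comp (snd.comp snd)) (hi.comp fst)

end Ops

section Controls

variable {α N Y : Type*} [Primcodable α] [Primcodable N] [Primcodable Y]

theorem primrec_pending {s : α → Bool} {A B C : α → N} (hs : Primrec s) (hA : Primrec A)
    (hB : Primrec B) (hC : Primrec C) :
    Primrec fun a => (⟨s a, A a, B a, C a⟩ : Pending N) :=
  (Primrec.of_equiv_symm (e := Pending.equiv)).comp (pair hs (pair hA (pair hB hC)))

theorem primrec_side : Primrec (Pending.side : Pending N → Bool) :=
  fst.comp (Primrec.of_equiv (e := Pending.equiv))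

theorem primrec_lhs : Primrec (Pending.lhs : Pending N → N) :=
  fst.comp (snd.comp (Primrec.of_equiv (e := Pending.equiv)))

theorem primrec_spine : Primrec (Pending.spine : Pending N → N) :=
  fst.comp (snd.comp (snd.comp (Primrec.of_equiv (e := Pending.equiv))))

theorem primrec_callee : Primrec (Pending.callee : Pending N → N) :=
  snd.comp (snd.comp (snd.comp (Primrec.of_equiv (e := Pending.equiv))))

theorem primrec_done : Primrec (Mode.done : N → Mode N) :=
  (Primrec.of_equiv_symm (e := Mode.equiv)).comp (sumInl.comp option_some)

theorem primrec_control {m : α → Mode N} {r : α → List (Pending N)} (hm : Primrec m)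
    (hr : Primrec r) : Primrec fun a => (some (m a, r a) : Control N) :=
  option_some.comp (pair hm hr)

theorem primrec_edge {p q : α → Control N} {u : α → List Y} {j : α → ℕ} {o : α → Op}
    (hp : Primrec p) (hu : Primrec u) (hj : Primrec j) (ho : Primrec o) (hq : Primrec q) :
    Primrec fun a => ((p a, u a, j a, o a, q a) : Edge N Y) :=
  pair hp (pair hu (pair hj (pair ho hq)))

end Controls

/-- A family of grammars with nets whose components are primitive recursive. -/
structure PrimrecFamily {α N Y : Type*} [Primcodable α] [Primcodable N] [Primcodable Y]
    (S : α → NetGrammar N Y) : Prop where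
  dim : Primrec fun a => (S a).dim
  top : Primrec fun a => (S a).top
  start : Primrec fun a => (S a).start
  nils : Primrec fun a => (S a).nils
  leaves : Primrec fun a => (S a).leaves
  bins : Primrec fun a => (S a).bins
  silent : Primrec fun a => (S a).silent
  initMarking : Primrec fun a => (S a).initMarking
  final : Primrec fun a => (S a).final

namespace PrimrecFamily

variable {α N Y : Type*} [Primcodable α] [Primcodable N] [Primcodable Y]
  {S : α → NetGrammar N Y}

theorem comp {β : Type*} [Primcodable β] (hS : PrimrecFamily S) {f : β → α}
    (hf : Primrec f) : PrimrecFamily fun b => S (f b) :=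
  ⟨hS.dim.comp hf, hS.top.comp hf, hS.start.comp hf, hS.nils.comp hf, hS.leaves.comp hf,
    hS.bins.comp hf, hS.silent.comp hf, hS.initMarking.comp hf, hS.final.comp hf⟩

theorem numCounters (hS : PrimrecFamily S) : Primrec fun a => (S a).numCounters :=
  nat_mul.comp (succ.comp hS.top) (nat_double.comp hS.dim)

theorem opList (hS : PrimrecFamily S) {o : α → Op} (ho : Primrec o) :
    Primrec fun a => (S a).opList (o a) := by
  have hdim : Primrec fun x : α × ℕ => (S x.1).dim := hS.dim.comp fst
  have hmod := nat_mod.comp snd (nat_double.comp hdim)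
  exact list_map (list_range.comp hS.numCounters) (primrec_opEntry (ho.comp fst)
    (nat_div.comp snd (nat_double.comp hdim))
    (Primrec.eq.comp (nat_div.comp hmod hdim) (const 1)).decide (nat_mod.comp snd hdim))

theorem pendings (hS : PrimrecFamily S) : Primrec fun a => (S a).pendings := by
  have hA : Primrec fun x : α × N × N × N => x.2.1 := fst.comp snd
  have hB : Primrec fun x : α × N × N × N => x.2.2.1 := fst.comp (snd.comp snd)
  have hC : Primrec fun x : α × N × N × N => x.2.2.2 := snd.comp (snd.comp snd)
  exact list_flatMap hS.bins (list_cons.comp (primrec_pending (const true) hA hB hC)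
    (list_cons.comp (primrec_pending (const false) hA hC hB) (const [])))

theorem pendingStacks (hS : PrimrecFamily S) {m : α → ℕ} (hm : Primrec m) :
    Primrec fun a => (S a).pendingStacks (m a) := by
  refine nat_rec' (f := m) (g := fun _ => [[]])
    (h := fun a x => (S a).pendings.flatMap fun p => x.2.map fun r => p :: r) hm (const [[]]) ?_
  exact list_flatMap (hS.pendings.comp fst)
    (list_map (snd.comp (snd.comp fst)) (list_cons.comp (snd.comp fst) snd))

theorem silentModes (hS : PrimrecFamily S) : Primrec fun a => (S a).silentModes :=
  list_cons.comp (const Mode.idle) (list_map hS.leaves (primrec_done.comp (fst.comp snd)))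

theorem leafEdges (hS : PrimrecFamily S) {l : α → ℕ} {r : α → List (Pending N)}
    (hl : Primrec l) (hr : Primrec r) : Primrec fun a => (S a).leafEdges (l a) (r a) := by
  have hidle : Primrec fun a => (some (.idle, r a) : Control N) :=
    primrec_control (const _) hr
  refine list_append.comp (list_append.comp (list_append.comp ?_ ?_) ?_) ?_
  · exact list_map (list_range.comp hS.dim) (primrec_edge (hidle.comp fst) (const []) (const 0)
      (primrec_guessOp (hl.comp fst) snd) (hidle.comp fst))
  · have hmode : Primrec fun x : (α × Mode N) × List ℤ => (some (x.1.2, r x.1.1) : Control N) :=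
      primrec_control (snd.comp fst) (hr.comp (fst.comp fst))
    exact list_flatMap hS.silentModes (list_map (hS.silent.comp fst) (primrec_edge hmode
      (const []) (const 0) (primrec_fireOp (hl.comp (fst.comp fst)) snd) hmode))
  · exact list_map hS.nils (primrec_edge (hidle.comp fst) (const []) (const 0) (const [])
      (primrec_control (primrec_done.comp snd) (hr.comp fst)))
  · exact list_map hS.leaves (primrec_edge (hidle.comp fst) (fst.comp (snd.comp snd)) (const 0)
      (primrec_fireOp (hl.comp fst) (snd.comp (snd.comp snd)))
      (primrec_control (primrec_done.comp (fst.comp snd)) (hr.comp fst)))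

theorem callEdges (hS : PrimrecFamily S) {l : α → ℕ} {p : α → Pending N}
    {r : α → List (Pending N)} (hl : Primrec l) (hp : Primrec p) (hr : Primrec r) :
    Primrec fun a => (S a).callEdges (l a) (p a) (r a) := by
  have hpr : Primrec fun a => p a :: r a := list_cons.comp hp hr
  have hmode (m : Mode N) : Primrec fun a => (some (m, p a :: r a) : Control N) :=
    primrec_control (const _) hpr
  have hside : Primrec fun x : α × ℕ => (p x.1).side := primrec_side.comp (hp.comp fst)
  refine list_append.comp (list_append.comp (list_cons.comp ?_ (list_cons.comp ?_
    (list_cons.comp ?_ (list_cons.comp ?_ (const []))))) ?_) ?_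
  · exact primrec_edge (primrec_control (primrec_done.comp (primrec_spine.comp hp)) hr)
      (const []) (const 0) (const []) (hmode .idle)
  · exact primrec_edge (primrec_control (primrec_done.comp (primrec_callee.comp hp)) hpr)
      (const []) (const 0) (const []) (hmode .take)
  · exact primrec_edge (hmode .take) (const []) (const 0) (const []) (hmode .put)
  · exact primrec_edge (hmode .put) (const []) (succ.comp hl) (const [])
      (primrec_control (primrec_done.comp (primrec_lhs.comp hp)) hr)
  · exact list_map (list_range.comp hS.dim) (primrec_edge ((hmode .take).comp fst) (const [])
      (const 0) (primrec_takeOp (hl.comp fst) hside snd) ((hmode .take).comp fst))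
  · exact list_map (list_range.comp hS.dim) (primrec_edge ((hmode .put).comp fst) (const [])
      (const 0) (primrec_putOp (hl.comp fst) hside snd) ((hmode .put).comp fst))

theorem finalEdges (hS : PrimrecFamily S) : Primrec fun a => (S a).finalEdges := by
  have htop : Primrec fun x : α × List ℕ => (S x.1).top := hS.top.comp fst
  exact list_map hS.final (primrec_edge
    (primrec_control (primrec_done.comp (hS.start.comp fst)) (const [])) (const []) (const 0)
    (primrec_transferOp (list_cons.comp
      (pair htop (pair (const false) (hS.initMarking.comp fst)))
      (list_cons.comp (pair htop (pair (const true) snd)) (const []))) (const []))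
    (const none))

theorem stackEdges (hS : PrimrecFamily S) {l : α → ℕ} {r : α → List (Pending N)}
    (hl : Primrec l) (hr : Primrec r) : Primrec fun a => (S a).stackEdges (l a) (r a) :=
  (list_casesOn hr hS.finalEdges ((hS.comp fst).callEdges (hl.comp fst) (fst.comp snd)
    (snd.comp snd)).to₂).of_eq fun a => by cases h : r a <;> simp only [NetGrammar.stackEdges]

theorem edges (hS : PrimrecFamily S) : Primrec fun a => (S a).edges := by
  have hstack : Primrec fun x : (α × ℕ) × List (Pending N) => x.1.1 := fst.comp fst
  have hl : Primrec fun x : (α × ℕ) × List (Pending N) => (S x.1.1).top - x.1.2 :=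
    nat_sub.comp (hS.top.comp hstack) (snd.comp fst)
  exact list_flatMap (list_range.comp (succ.comp hS.top))
    (list_flatMap ((hS.comp fst).pendingStacks snd) (list_append.comp
      ((hS.comp hstack).leafEdges hl snd) ((hS.comp hstack).stackEdges hl snd)))

theorem controlBound (hS : PrimrecFamily S) : Primrec fun a => (S a).controlBound :=
  nat_add.comp ((primrec_list_sum nat_add).comp (list_map hS.edges
    (nat_add.comp (Primrec.encode.comp (fst.comp snd))
      (Primrec.encode.comp (snd.comp (snd.comp (snd.comp (snd.comp snd)))))))) (const _)

theorem edgeCode (hS : PrimrecFamily S) {e : α → Edge N Y} (he : Primrec e) :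
    Primrec fun a => (S a).edgeCode (e a) :=
  pair (Primrec.encode.comp (fst.comp he)) (pair (fst.comp (snd.comp he))
    (pair (nat_mul.comp (fst.comp (snd.comp (snd.comp he))) (nat_double.comp hS.dim))
      (pair (hS.opList (fst.comp (snd.comp (snd.comp (snd.comp he)))))
        (Primrec.encode.comp (snd.comp (snd.comp (snd.comp (snd.comp he))))))))

theorem machineCode {S : α → NetGrammar N ℕ} (hS : PrimrecFamily S) :
    Primrec fun a => (S a).machineCode :=
  (Primrec.of_equiv_symm (e := MachineCode.equiv)).comp (pair hS.numCounters
    (pair hS.controlBound (pair (list_map hS.edges ((hS.comp fst).edgeCode snd).to₂)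
      (pair (const _) (const _)))))

end PrimrecFamily

theorem primrec_joinLeaves {α N X Y : Type*} [Primcodable α] [Primcodable N] [Primcodable X]
    [DecidableEq X] [Primcodable Y] {h : α → X → List Y} {terms : α → List (N × X)}
    {transitions : α → List (Option X × List ℤ)} (hh : Primrec₂ h) (hterms : Primrec terms)
    (htransitions : Primrec transitions) :
    Primrec fun a => joinLeaves (h a) (terms a) (transitions a) := by
  refine list_flatMap hterms (listFilterMap (htransitions.comp fst) (Primrec.ite
    (Primrec.eq.comp (fst.comp snd) (option_some.comp (snd.comp (snd.comp fst)))) ?_ (const none)))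
  exact option_some.comp (pair (fst.comp (snd.comp fst)) (pair
    (hh.comp (fst.comp fst) (snd.comp (snd.comp fst))) (snd.comp snd)))

theorem primrec_silentEffects {X : Type*} [Primcodable X] :
    Primrec (silentEffects : List (Option X × List ℤ) → List (List ℤ)) := by
  classical
  exact (listFilterMap .id (Primrec.ite (Primrec.eq.comp (fst.comp snd) (const none))
    (option_some.comp (snd.comp snd)) (const none)).to₂).of_eq fun t => by
      simp only [silentEffects, id_eq]

end NetGrammar

namespace LanguageCode

open Primrec

theorem primrec_nilRule : Primrec nilRule :=
  Primrec.ite (Primrec.eq.comp (list_length.comp snd) (const 0)) (option_some.comp fst)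
    (const none)

theorem primrec_getElem?_bind_getLeft? (i : ℕ) : Primrec fun r : ℕ × List (ℕ ⊕ ℕ) =>
    r.2[i]?.bind Sum.getLeft? := by
  have hget : Primrec (Sum.getLeft? : ℕ ⊕ ℕ → Option ℕ) :=
    (sumCasesOn (g := fun _ => some) (h := fun _ _ => none) .id (option_some.comp snd)
      (const none)).of_eq fun x => by cases x <;> rfl
  exact option_bind (list_getElem?.comp snd (const i)) (hget.comp snd)

theorem primrec_getElem?_bind_getRight? (i : ℕ) : Primrec fun r : ℕ × List (ℕ ⊕ ℕ) =>
    r.2[i]?.bind Sum.getRight? := by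
  have hget : Primrec (Sum.getRight? : ℕ ⊕ ℕ → Option ℕ) :=
    (sumCasesOn (g := fun _ _ => none) (h := fun _ => some) .id (const none)
      (option_some.comp snd)).of_eq fun x => by cases x <;> rfl
  exact option_bind (list_getElem?.comp snd (const i)) (hget.comp snd)

theorem primrec_leafRule : Primrec leafRule :=
  option_map (primrec_getElem?_bind_getLeft? 0) (pair (fst.comp fst) snd)

theorem primrec_binRule : Primrec binRule :=
  option_bind (primrec_getElem?_bind_getRight? 0)
    (option_map ((primrec_getElem?_bind_getRight? 1).comp fst)
      (pair (fst.comp (fst.comp fst)) (pair (snd.comp fst) snd)))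

theorem primrecFamily_netGrammar : NetGrammar.PrimrecFamily netGrammar := by
  have hcode : Primrec LanguageCode.equiv := Primrec.of_equiv
  have hgrammar : Primrec fun c : LanguageCode => GrammarCode.equiv c.grammar :=
    (Primrec.of_equiv (e := GrammarCode.equiv)).comp (fst.comp hcode)
  have hnet : Primrec fun c : LanguageCode => PetriNetCode.equiv c.net :=
    (Primrec.of_equiv (e := PetriNetCode.equiv)).comp (fst.comp (snd.comp (snd.comp hcode)))
  have hrules : Primrec fun c : LanguageCode => c.grammar.rules := snd.comp hgrammar
  have htransitions : Primrec fun c : LanguageCode => c.net.transitions :=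
    fst.comp (snd.comp hnet)
  have himages : Primrec₂ fun (c : LanguageCode) x => c.images.getD x [] :=
    (list_getD []).comp (snd.comp (snd.comp (snd.comp (hcode.comp fst)))) snd
  exact {
    dim := fst.comp hnet
    top := nat_sub.comp (fst.comp (snd.comp hcode)) (const 1)
    start := fst.comp hgrammar
    nils := listFilterMap hrules (primrec_nilRule.comp snd)
    leaves := NetGrammar.primrec_joinLeaves himages
      (listFilterMap hrules (primrec_leafRule.comp snd)) htransitions
    bins := listFilterMap hrules (primrec_binRule.comp snd)
    silent := NetGrammar.primrec_silentEffects.comp htransitions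
    initMarking := fst.comp (snd.comp (snd.comp hnet))
    final := snd.comp (snd.comp (snd.comp hnet)) }

end LanguageCode

theorem mainTheorem4_general :
    (∀ {X : Type} {Y : Type*} [DecidableEq Y] (h : X → List Y) {K L : Language X},
      IsFiniteIndexCF K → IsPetriNetLanguage L → ∃ (k : ℕ) (A : PriorityMachine Y k),
        parikhImage A.language = parikhImage (morphicIntersection h K L)) ∧
    ∃ F : LanguageCode → MachineCode, Primrec F ∧
      ∀ c : LanguageCode, c.Valid →
        parikhImage (F c).toMachine.language = parikhImage c.language := by
  refine ⟨?_, fun c => c.netGrammar.machineCode,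
    LanguageCode.primrecFamily_netGrammar.machineCode,
    fun _ => LanguageCode.parikhImage_machineCode⟩
  rintro X Y _ h _ _ ⟨k, hk, G, hG, rfl⟩ ⟨d, P, rfl⟩
  obtain ⟨S, P', htop, hP, hS⟩ := NetGrammar.exists_represents G (k - 1) P h
  obtain ⟨A, name, hA⟩ := S.exists_isMachine
  refine ⟨_, A, parikhImage_eq_of_multisets fun v => ?_⟩
  rw [← hA.mem_images_iff, hS.mem_images_iff hG, hP, htop, Nat.sub_add_cancel hk]

theorem mainTheorem4 :
    (∀ (Y : Type) [Finite Y] [DecidableEq Y] (K : Language Y),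
      InTrioIntersection (fun _ L => IsFiniteIndexCF L) (fun _ L => IsPetriNetLanguage L) K →
      ∃ (k : ℕ) (A : PriorityMachine Y k), parikhImage A.language = parikhImage K) ∧
    (∃ F : LanguageCode → MachineCode, Computable F ∧
      ∀ c : LanguageCode, c.Valid →
        parikhImage (F c).toMachine.language = parikhImage c.language) := by
  obtain ⟨hmachine, F, hF, hcode⟩ := mainTheorem4_general
  refine ⟨?_, F, hF.to_comp, hcode⟩
  rintro Y _ _ _ ⟨X, _, h, K, L, hK, hL, rfl⟩
  exact hmachine h hK hL
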